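/- Conventions. For a topological group $G$, a *$G$-flow* is a compact Hausdorff space $X$ with a jointly continuous right action of $G$; it is *minimal* if it is nonempty and all its orbits are dense. A *$G$-map* is a continuous map that commutes with the actions. The *universal minimal flow* $M(G)$ is the minimal $G$-flow, unique up to isomorphism, that admits a $G$-map to every minimal $G$-flow. A Polish group $G$ has the *generic point property* if $M(G)$ has a comeager (generic) orbit. $S_\infty$ is the group of permutations of $\mathbb N$ with the topology of pointwise convergence. A Polish group is *non-Archimedean* if every neighbourhood of the identity contains an open subgroup. A relational Fraïssé structure on $\mathbb N$ is a structure $\mathbf K$ with universe $\mathbb N$ in a relational language $L$ such that every embedding of a finite substructure of $\mathbf K$ into $\mathbf K$ extends to an automorphism of $\mathbf K$. Its age $\mathcal K$ is the class of finite $L$-structures that embed in $\mathbf K$. Let $\mathcal S$ be a countable set of new relation symbols. A class $\mathcal K^*$ of finite $(L\cup\mathcal S)$-structures, closed under isomorphism, is an *expansion* of $\mathcal K$ if the $L$-reducts of its members are exactly the members of $\mathcal K$; an expansion of $\mathbf A\in\mathcal K$ is an $\mathbf A^*\in\mathcal K^*$ with $\mathbf A^*|_L=\mathbf A$. The pair $(\mathcal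 K^*,\mathcal K)$ is *excellent* if $\mathcal K^*$ is a Fraïssé class and an expansion of $\mathcal K$ such that * (precompact) every $\mathbf A\in\mathcal K$ has only finitely many expansions; * (reasonable) for every embedding $f:\mathbf A\to\mathbf B$ of members of $\mathcal K$ and every expansion $\mathbf A^*$ of $\mathbf A$ there is an expansion $\mathbf B^*$ of $\mathbf B$ such that $f:\mathbf A^*\to\mathbf B^*$ is an embedding; * (expansion property) for every $\mathbf A^*\in\mathcal K^*$ there is $\mathbf B\in\mathcal K$ such that $\mathbf A^*$ embeds in every expansion of $\mathbf B$; * (Ramsey property for embeddings) for all $\mathbf A,\mathbf B\in\mathcal K^*$ such that $\mathbf A$ embeds in $\mathbf B$ there is $\mathbf C\in\mathcal K^*$ in which $\mathbf A$ embeds, such that for every $2$-colouring of $\mathrm{Emb}(\mathbf A,\mathbf C)$ there is $f\in\mathrm{Emb}(\mathbf B,\mathbf C)$ with $f\circ\mathrm{Emb}(\mathbf A,\mathbf B)$ monochromatic. Then $X_{\mathcal K^*}$ is the space of all expansions $\langle\mathbf K,\vec S\rangle$ of $\mathbf K$ whose finite substructures all lie in $\mathcal K^*$. Its basic open sets consist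 of the $\langle\mathbf K,\vec S\rangle$ with a prescribed restriction to a given finite subset of $\mathbb N$. The group $\mathrm{Aut}(\mathbf K)$ acts on it from the right: $S_i$ holds at $\bar x$ in $\mathbf K'\cdot g$ if and only if it holds at $g(\bar x)$ in $\mathbf K'$. **Corollary 8.15.** 1. If $G$ is a closed subgroup of $S_\infty$ and $M(G)$ is metrizable, then $G$ has the generic point property, that is, $M(G)$ has a comeager orbit. 2. The same holds for every non-Archimedean Polish group $G$. (This answers the Generic Point Problem of Angel, Kechris and Lyons for these groups.) 3. The closed subgroups of $S_\infty$ are exactly the groups $\mathrm{Aut}(\mathbf K)$ for relational Fraïssé structures $\mathbf K$ on $\mathbb N$. For every such $\mathbf K$, with age $\mathcal K$ and $G=\mathrm{Aut}(\mathbf K)$: if $M(G)$ is metrizable, then there are a countable set $\mathcal S$ of new relation symbols, a class $\mathcal K^*$ of finite $(L\cup\mathcal S)$-structures with $(\mathcal K^*,\mathcal K)$ excellent, a point $\mathbf K^*\in X_{\mathcal K^*}$ that is a Fraïssé limit of $\mathcal K^*$ (ultrahomogeneous with age $\mathcal K^*$), and an isomorphism of $G$-flows $X_{\mathcal K^*}\cong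 M(G)$, such that the orbit of $\mathbf K^*$ is the unique generic orbit: a point of $M(G)$ has a comeager orbit if and only if it lies in the image of $\mathbf K^*\cdot G$. -/

import Mathlib

open scoped FirstOrder
open CategoryTheory (Bundled)

universe u v a b

namespace Dynamics

/-! ### The group of permutations of the natural numbers -/

/-- The topology of pointwise convergence on the group of permutations of `ℕ` (with `ℕ` discrete). -/
instance permTopology : TopologicalSpace (Equiv.Perm ℕ) :=
  TopologicalSpace.induced (fun g : Equiv.Perm ℕ => (g : ℕ → ℕ)) inferInstance

/-! ### Flows -/

section Flows

/-- `X` with its right action of `G` (an action of `Gᵐᵒᵖ`; `x · g` is `MulOpposite.op g • x`)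
is a minimal `G`-flow: a nonempty compact Hausdorff space on which `G` acts continuously
(jointly), all of whose orbits are dense. -/
structure IsMinimalFlow (G : Type u) [Group G] [TopologicalSpace G]
    (X : Type v) [TopologicalSpace X] [MulAction Gᵐᵒᵖ X] : Prop where
  compact : CompactSpace X
  hausdorff : T2Space X
  continuous : ContinuousSMul Gᵐᵒᵖ X
  nonempty : Nonempty X
  minimal : ∀ x : X, Dense (MulAction.orbit Gᵐᵒᵖ x)

/-- A `G`-map: a continuous map which respects the right actions of `G`. -/
def IsGMap (G : Type u) [Group G] {X : Type*} {Y : Type*} [TopologicalSpace X]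
    [TopologicalSpace Y] [MulAction Gᵐᵒᵖ X] [MulAction Gᵐᵒᵖ Y] (f : X → Y) : Prop :=
  Continuous f ∧ ∀ (g : G) (x : X), f (MulOpposite.op g • x) = MulOpposite.op g • f x

/-- `M` is the universal minimal flow of `G`: a minimal flow that admits a `G`-map to every
minimal flow. -/
structure IsUniversalMinimalFlow (G : Type u) [Group G] [TopologicalSpace G]
    (M : Type v) [TopologicalSpace M] [MulAction Gᵐᵒᵖ M] : Prop where
  isMinimalFlow : IsMinimalFlow G M
  universal : ∀ (Y : Type v) [TopologicalSpace Y] [MulAction Gᵐᵒᵖ Y],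
    IsMinimalFlow G Y → ∃ f : M → Y, IsGMap G f

/-- The universal minimal flow of `G` is metrizable. -/
def HasMetrizableUniversalMinimalFlow (G : Type u) [Group G] [TopologicalSpace G] : Prop :=
  ∃ (M : Type v) (_ : TopologicalSpace M) (_ : MulAction Gᵐᵒᵖ M),
    IsUniversalMinimalFlow G M ∧ TopologicalSpace.MetrizableSpace M

/-- The orbit of `x` is generic, that is, comeager. -/
def HasGenericOrbit (G : Type u) [Group G] {X : Type v} [TopologicalSpace X]
    [MulAction Gᵐᵒᵖ X] (x : X) : Prop :=
  MulAction.orbit Gᵐᵒᵖ x ∈ residual X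

/-- The generic point property: the universal minimal flow exists (as it always does) and
has a generic orbit, whichever of its isomorphic copies one takes. -/
def GenericPointProperty (G : Type u) [Group G] [TopologicalSpace G] : Prop :=
  (∃ (M : Type v) (_ : TopologicalSpace M) (_ : MulAction Gᵐᵒᵖ M), IsUniversalMinimalFlow G M) ∧
  ∀ (M : Type v) [TopologicalSpace M] [MulAction Gᵐᵒᵖ M],
    IsUniversalMinimalFlow G M → ∃ x : M, HasGenericOrbit G x

end Flows

/-! ### Structures on `ℕ`, expansions, and the logic action -/

section Structures

/-- The automorphism group of a structure with universe `ℕ`, as a group of permutations. -/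
def autGroup (L : FirstOrder.Language.{a, b}) [L.Structure ℕ] : Subgroup (Equiv.Perm ℕ) where
  carrier := {g | ∃ φ : ℕ ≃[L] ℕ, φ.toEquiv = g}
  one_mem' := ⟨FirstOrder.Language.Equiv.refl L ℕ, rfl⟩
  mul_mem' := by
    rintro g h ⟨φ, rfl⟩ ⟨ψ, rfl⟩
    exact ⟨φ.comp ψ, rfl⟩
  inv_mem' := by
    rintro g ⟨φ, rfl⟩
    exact ⟨φ.symm, rfl⟩

variable {L : FirstOrder.Language.{a, b}} {S : FirstOrder.Language.{0, 0}}

/-- The `L ∪ S`-structure that expands the `L`-structure `A` by the `S`-structure `s` on the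
same universe. -/
def expand (A : Bundled.{0} L.Structure) (s : S.Structure A) :
    Bundled.{0} (L.sum S).Structure :=
  letI := s
  ⟨A, FirstOrder.Language.sumStructure L S A⟩

/-- The `S`-structures `s` for which `⟨A, s⟩` is an expansion of `A` in the class `𝒦s`. -/
def expansions (𝒦s : Set (Bundled.{0} (L.sum S).Structure)) (A : Bundled.{0} L.Structure) :
    Set (S.Structure A) :=
  {s | expand A s ∈ 𝒦s}

/-- `𝒦s` is an expansion of the class `𝒦`: it is closed under isomorphism and its `L`-reducts
are exactly the members of `𝒦`. -/
def IsExpansionClass (𝒦s : Set (Bundled.{0} (L.sum S).Structure))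
    (𝒦 : Set (Bundled.{0} L.Structure)) : Prop :=
  (∀ A B : Bundled.{0} (L.sum S).Structure, Nonempty (A ≃[L.sum S] B) → A ∈ 𝒦s → B ∈ 𝒦s) ∧
  ∀ A : Bundled.{0} L.Structure, A ∈ 𝒦 ↔ (expansions 𝒦s A).Nonempty

/-- Every member of `𝒦` has only finitely many expansions in `𝒦s`. -/
def IsPrecompact (𝒦s : Set (Bundled.{0} (L.sum S).Structure))
    (𝒦 : Set (Bundled.{0} L.Structure)) : Prop :=
  ∀ A ∈ 𝒦, (expansions 𝒦s A).Finite

/-- For every embedding `f : A → B` in `𝒦` and every expansion of `A` there is an expansion of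
`B` such that `f` is an embedding of the expansions. -/
def IsReasonable (𝒦s : Set (Bundled.{0} (L.sum S).Structure))
    (𝒦 : Set (Bundled.{0} L.Structure)) : Prop :=
  ∀ A ∈ 𝒦, ∀ B ∈ 𝒦, ∀ f : A ↪[L] B, ∀ s ∈ expansions 𝒦s A,
    ∃ t ∈ expansions 𝒦s B, ∃ h : expand A s ↪[L.sum S] expand B t, ∀ x : A, h x = f x

/-- For every `A*` in `𝒦s` there is `B` in `𝒦` all of whose expansions in `𝒦s` embed `A*`. -/
def HasExpansionProperty (𝒦s : Set (Bundled.{0} (L.sum S).Structure))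
    (𝒦 : Set (Bundled.{0} L.Structure)) : Prop :=
  ∀ As ∈ 𝒦s, ∃ B ∈ 𝒦, ∀ t ∈ expansions 𝒦s B, Nonempty (As ↪[L.sum S] expand B t)

/-- The Ramsey property for embeddings. -/
def HasRamseyProperty {L' : FirstOrder.Language.{a, b}} (𝒞 : Set (Bundled.{0} L'.Structure)) : Prop :=
  ∀ A ∈ 𝒞, ∀ B ∈ 𝒞, Nonempty (A ↪[L'] B) → ∃ C ∈ 𝒞, Nonempty (A ↪[L'] C) ∧
    ∀ γ : (A ↪[L'] C) → Fin 2, ∃ f : B ↪[L'] C,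
      ∀ e e' : A ↪[L'] B, γ (f.comp e) = γ (f.comp e')

/-- The pair `(𝒦s, 𝒦)` is excellent: `𝒦s` is a Fraïssé class, it is a reasonable precompact
expansion of `𝒦`, it has the expansion property relative to `𝒦`, and it has the Ramsey
property. -/
structure IsExcellent (𝒦s : Set (Bundled.{0} (L.sum S).Structure))
    (𝒦 : Set (Bundled.{0} L.Structure)) : Prop where
  fraisse : FirstOrder.Language.IsFraisse 𝒦s
  expansion : IsExpansionClass 𝒦s 𝒦
  precompact : IsPrecompact 𝒦s 𝒦
  reasonable : IsReasonable 𝒦s 𝒦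
  expansionProperty : HasExpansionProperty 𝒦s 𝒦
  ramsey : HasRamseyProperty 𝒦s

/-- The expansion `⟨K, s⟩` of the structure `K`, the given `L`-structure on `ℕ`. -/
def expandNat (L : FirstOrder.Language.{a, b}) [K : L.Structure ℕ] (s : S.Structure ℕ) :
    Bundled.{0} (L.sum S).Structure :=
  expand ⟨ℕ, K⟩ s

variable [L.Structure ℕ]

/-- The space of the expansions `⟨K, s⟩` of the structure `K` (the given `L`-structure on `ℕ`)
all of whose finitely generated substructures belong, up to isomorphism, to `𝒦s`. -/
def ExpansionSpace (𝒦s : Set (Bundled.{0} (L.sum S).Structure)) : Type :=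
  {s : S.Structure ℕ // (L.sum S).age (expandNat L s) ⊆ 𝒦s}

/-- `⟨K, s⟩` is a Fraïssé limit of `𝒦s`: it is ultrahomogeneous and its age is `𝒦s`. -/
def IsLimit {𝒦s : Set (Bundled.{0} (L.sum S).Structure)} (s : ExpansionSpace 𝒦s) : Prop :=
  (L.sum S).IsUltrahomogeneous (expandNat L s.1) ∧
    (L.sum S).age (expandNat L s.1) = 𝒦s

namespace ExpansionSpace

variable {𝒦s : Set (Bundled.{0} (L.sum S).Structure)}

/-- The `s` whose restriction to the finite set `F` is the restriction of `t`. -/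
def basicOpen (F : Finset ℕ) (t : ExpansionSpace 𝒦s) : Set (ExpansionSpace 𝒦s) :=
  {s | ∀ (n : ℕ) (r : S.Relations n) (x : Fin n → ℕ),
    (∀ i, x i ∈ F) → (s.1.RelMap r x ↔ t.1.RelMap r x)}

instance : TopologicalSpace (ExpansionSpace 𝒦s) :=
  TopologicalSpace.generateFrom {U | ∃ F t, U = basicOpen F t}

/-- The right translate `s · g` of a relational structure on `ℕ`: the relation `r` holds at `x`
for `s · g` iff it holds at `g x` for `s`. -/
@[reducible]
def translate [S.IsRelational] (s : S.Structure ℕ) (g : Equiv.Perm ℕ) : S.Structure ℕ where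
  funMap := fun f => isEmptyElim f
  RelMap := fun r x => s.RelMap r (g ∘ x)

/-- An automorphism of `K` is an isomorphism of `⟨K, s · g⟩` and `⟨K, s⟩`. -/
def translateEquiv [S.IsRelational] (s : S.Structure ℕ) (φ : ℕ ≃[L] ℕ) :
    expandNat L (translate s φ.toEquiv)
      ≃[L.sum S] expandNat L s where
  toEquiv := φ.toEquiv
  map_fun' := by
    intro n f x
    rcases f with f | f
    · exact φ.map_fun' f x
    · exact isEmptyElim f
  map_rel' := by
    intro n r x
    rcases r with r | r
    · exact φ.map_rel' r x
    · exact Iff.rfl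

theorem age_translate [S.IsRelational] (s : S.Structure ℕ) {g : Equiv.Perm ℕ}
    (hg : g ∈ autGroup L) :
    (L.sum S).age (expandNat L (translate s g)) =
      (L.sum S).age (expandNat L s) := by
  obtain ⟨φ, rfl⟩ := hg
  exact (translateEquiv s φ).age_eq_age

/-- The right logic action of the automorphism group of `K`. -/
instance [S.IsRelational] : MulAction (autGroup L)ᵐᵒᵖ (ExpansionSpace 𝒦s) where
  smul g s := ⟨translate s.1 g.unop.1, by
    rw [age_translate s.1 g.unop.2]; exact s.2⟩
  one_smul s := by
    apply Subtype.ext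
    apply FirstOrder.Language.Structure.ext
    · funext n f
      exact isEmptyElim f
    · rfl
  mul_smul g h s := by
    apply Subtype.ext
    apply FirstOrder.Language.Structure.ext
    · funext n f
      exact isEmptyElim f
    · rfl

end ExpansionSpace

end Structures

end Dynamics

set_option linter.unusedSectionVars false

open Topology Filter Set

/-! Write Γ for the opposite group of `G`, which acts on the left. The greatest ambit is the Stone
space of the algebra of those subsets of Γ that are invariant under left multiplication by some open
subgroup. Here it is the orbit closure of `Ambit.base`, and any minimal subflow N of it maps to
every flow (`Ambit.exists_map`). If a universal minimal flow is metrizable, it maps onto N, so N has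
only countably many clopen sets. For open U, the U-invariant clopen sets of N inject into the image
of a homomorphism defined on the power set of the coset space U\Γ, and such an image is finite as
soon as it is countable (`finite_range_of_countable_range`). So N has finitely many types over each
open subgroup: `HasFiniteTypes`.

Finiteness drives the rest. Taking preimages under an equivariant self-map of N permutes each of
these finite algebras, so the map is injective (`injective_of_isFlowMap`). Hence every nonempty
closed invariant subset of N × Y contains the graph of a flow map (`exists_section`). For Y the flow
of two-colourings of U\Γ this yields `exists_limit_coloring`: up to translation, and on finite sets,
a colouring is decided by one invariant clopen set. This is the Ramsey property in dynamical form,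
and amalgamation of types (`exists_smul_mem_of_sameType`) follows from it.

By amalgamation the one-point extension property `HasTypeExtension` is a countable intersection of
dense open conditions, hence comeager. When `G` is the automorphism group of an ultrahomogeneous K,
a point of N is encoded by the expansion of K that records its types over finite sets. By minimality
all points give the same age. Points with the extension property give ultrahomogeneous expansions,
so by uniqueness of Fraïssé limits they lie in a single orbit, which is therefore comeager. The
encoding is a homeomorphism of N onto the space of expansions. Precompactness comes from finiteness
of types, the expansion property from minimality, the Ramsey property from limit colourings. A
non-Archimedean Polish group becomes a closed permutation group through its action on cosets of
small open subgroups. -/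

namespace Dynamics

section Core

variable {Γ : Type u} [Group Γ]

/-! ### Maps of flows and minimal subflows -/

/-- A continuous equivariant map. -/
def IsFlowMap (Γ : Type*) [Group Γ] {X Y : Type*} [TopologicalSpace X] [TopologicalSpace Y]
    [MulAction Γ X] [MulAction Γ Y] (f : X → Y) : Prop :=
  Continuous f ∧ ∀ (γ : Γ) (x : X), f (γ • x) = γ • f x

theorem IsFlowMap.surjective {X Y : Type*} [TopologicalSpace X] [TopologicalSpace Y]
    [MulAction Γ X] [MulAction Γ Y] [CompactSpace X] [Nonempty X] [T2Space Y]
    [MulAction.IsMinimal Γ Y] {f : X → Y} (hf : IsFlowMap Γ f) : Function.Surjective f := by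
  have hd : Dense (range f) := by
    obtain ⟨x⟩ := ‹Nonempty X›
    refine (MulAction.dense_orbit Γ (f x)).mono ?_
    rintro _ ⟨γ, rfl⟩
    exact ⟨γ • x, hf.2 γ x⟩
  have hc : IsClosed (range f) := (isCompact_range hf.1).isClosed
  rw [← range_eq_univ, ← hc.closure_eq, hd.closure_eq]

theorem exists_minimal_subset {X : Type*} [TopologicalSpace X] [CompactSpace X] [MulAction Γ X]
    (Q : Set X) (hQ : IsClosed Q) (hQn : Q.Nonempty) (hQi : ∀ γ : Γ, ∀ x ∈ Q, γ • x ∈ Q) :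
    ∃ Z ⊆ Q, Minimal (fun Z : Set X =>
      IsClosed Z ∧ Z.Nonempty ∧ ∀ γ : Γ, ∀ x ∈ Z, γ • x ∈ Z) Z := by
  refine zorn_superset_nonempty
    {Z : Set X | IsClosed Z ∧ Z.Nonempty ∧ ∀ γ : Γ, ∀ x ∈ Z, γ • x ∈ Z} ?_ Q ⟨hQ, hQn, hQi⟩
  intro c hc hchain hcn
  refine ⟨⋂₀ c, ⟨isClosed_sInter fun Z hZ => (hc hZ).1, ?_, ?_⟩, fun s hs => sInter_subset_of_mem hs⟩
  · have := hcn.to_subtype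
    rw [sInter_eq_iInter]
    refine IsCompact.nonempty_iInter_of_directed_nonempty_isCompact_isClosed _ ?_
      (fun Z => (hc Z.2).2.1) (fun Z => (hc Z.2).1.isCompact) (fun Z => (hc Z.2).1)
    intro Z W
    rcases hchain.total Z.2 W.2 with h | h
    · exact ⟨Z, Subset.rfl, h⟩
    · exact ⟨W, h, Subset.rfl⟩
  · intro γ x hx Z hZ
    exact (hc hZ).2.2 γ x (hx Z hZ)

instance subMulAction_continuousSMul {X : Type*} [TopologicalSpace X] [TopologicalSpace Γ]
    [MulAction Γ X] [ContinuousSMul Γ X] (Z : SubMulAction Γ X) : ContinuousSMul Γ Z :=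
  ⟨Continuous.subtype_mk (continuous_fst.smul (continuous_subtype_val.comp continuous_snd)) _⟩

/-- The closed invariant set of a closed set stable under the action. -/
def subflow {X : Type*} [MulAction Γ X] (Q : Set X) (hQi : ∀ γ : Γ, ∀ x ∈ Q, γ • x ∈ Q) :
    SubMulAction Γ X := ⟨Q, fun γ {x} hx => hQi γ x hx⟩

theorem exists_minimal_subflow {X : Type*} [TopologicalSpace X] [CompactSpace X] [MulAction Γ X]
    [ContinuousConstSMul Γ X]
    (Q : Set X) (hQ : IsClosed Q) (hQn : Q.Nonempty) (hQi : ∀ γ : Γ, ∀ x ∈ Q, γ • x ∈ Q) :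
    ∃ Z : SubMulAction Γ X, (Z : Set X) ⊆ Q ∧ IsClosed (Z : Set X) ∧ Nonempty Z ∧
      MulAction.IsMinimal Γ Z := by
  obtain ⟨Z, hZQ, ⟨hZc, hZn, hZi⟩, hmin⟩ := exists_minimal_subset Q hQ hQn hQi
  refine ⟨subflow Z hZi, hZQ, hZc, hZn.to_subtype, ⟨?_⟩⟩
  rintro ⟨x, hx⟩
  have hsub : closure (MulAction.orbit Γ x) ⊆ Z := by
    refine closure_minimal ?_ hZc
    rintro _ ⟨γ, rfl⟩
    exact hZi γ x hx
  have hle : Z ⊆ closure (MulAction.orbit Γ x) := by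
    refine hmin ⟨isClosed_closure, (MulAction.nonempty_orbit x).closure, ?_⟩ hsub
    intro γ y hy
    exact smul_closure_orbit_subset γ x ⟨y, hy, rfl⟩
  rintro ⟨y, hy⟩
  rw [closure_subtype]
  refine closure_mono ?_ (hle hy)
  rintro _ ⟨γ, rfl⟩
  exact ⟨⟨γ • x, hZi γ x hx⟩, ⟨γ, rfl⟩, rfl⟩

/-! ### The greatest ambit of a nonarchimedean group -/

variable [TopologicalSpace Γ] [NonarchimedeanGroup Γ]

theorem eventually_mem_openSubgroup_mul (U : OpenSubgroup Γ) (γ : Γ) :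
    ∀ᶠ δ in 𝓝 γ, δ * γ⁻¹ ∈ U := by
  have : Continuous fun δ : Γ => δ * γ⁻¹ := by fun_prop
  exact this.continuousAt.eventually_mem (U.isOpen.mem_nhds (by simp))

/-- The sets that are invariant under left multiplication by some open subgroup. -/
def leftUniformSets (Γ : Type u) [Group Γ] [TopologicalSpace Γ] : Set (Set Γ) :=
  {A | ∃ U : OpenSubgroup Γ, ∀ u ∈ U, ∀ γ, u * γ ∈ A ↔ γ ∈ A}

/-- Since `γ * u * δ = (γ * u * γ⁻¹) * (γ * δ)`, invariance passes to a conjugate of the open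
subgroup. -/
theorem preimage_mul_mem_leftUniformSets {A : Set Γ} (hA : A ∈ leftUniformSets Γ) (γ : Γ) :
    {δ | γ * δ ∈ A} ∈ leftUniformSets Γ := by
  obtain ⟨U, hU⟩ := hA
  refine ⟨U.comap (MulAut.conj γ).toMonoidHom (by
    change Continuous fun δ => γ * δ * γ⁻¹
    fun_prop), fun u hu δ => ?_⟩
  have := hU (γ * u * γ⁻¹) hu (γ * δ)
  simpa [mul_assoc] using this

/-- The space of two-valued functions on the algebra of uniform sets. -/
def Ambit (Γ : Type u) [Group Γ] [TopologicalSpace Γ] : Type u := leftUniformSets Γ → Bool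

instance : TopologicalSpace (Ambit Γ) := inferInstanceAs (TopologicalSpace (leftUniformSets Γ → Bool))
instance : CompactSpace (Ambit Γ) := inferInstanceAs (CompactSpace (leftUniformSets Γ → Bool))
instance : T2Space (Ambit Γ) := inferInstanceAs (T2Space (leftUniformSets Γ → Bool))
instance : TotallyDisconnectedSpace (Ambit Γ) :=
  inferInstanceAs (TotallyDisconnectedSpace (leftUniformSets Γ → Bool))

instance : MulAction Γ (Ambit Γ) where
  smul γ p := fun A => p ⟨{δ | γ * δ ∈ A.1}, preimage_mul_mem_leftUniformSets A.2 γ⟩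
  one_smul p := by
    funext A
    change p ⟨{δ | 1 * δ ∈ A.1}, _⟩ = p A
    simp
  mul_smul γ₁ γ₂ p := by
    funext A
    change p ⟨{δ | γ₁ * γ₂ * δ ∈ A.1}, _⟩ = p ⟨{δ | γ₁ * (γ₂ * δ) ∈ A.1}, _⟩
    simp [mul_assoc]

theorem Ambit.smul_apply (γ : Γ) (p : Ambit Γ) (A : leftUniformSets Γ) :
    (γ • p) A = p ⟨{δ | γ * δ ∈ A.1}, preimage_mul_mem_leftUniformSets A.2 γ⟩ := rfl

theorem Ambit.continuous_apply (A : leftUniformSets Γ) : Continuous fun p : Ambit Γ => p A :=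
  _root_.continuous_apply (A := fun _ : leftUniformSets Γ => Bool) A

/-- If `A` is invariant under `U`, the coordinate `A` of `γ • p` depends on `γ` only through the
coset `Uγ`, so locally the action is a coordinate projection. -/
instance : ContinuousSMul Γ (Ambit Γ) where
  continuous_smul := by
    refine continuous_pi fun A => continuous_iff_continuousAt.2 ?_
    rintro ⟨γ, p⟩
    have h1 : ContinuousAt (fun q : Γ × Ambit Γ => (γ • q.2) A) (γ, p) :=
      ((Ambit.continuous_apply _).comp continuous_snd).continuousAt
    refine h1.congr ?_
    obtain ⟨U, hU⟩ := A.2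
    filter_upwards [continuous_fst.continuousAt.eventually (eventually_mem_openSubgroup_mul U γ)]
    rintro ⟨δ, q⟩ (hδ : δ * γ⁻¹ ∈ U)
    change (γ • q) A = (δ • q) A
    rw [Ambit.smul_apply, Ambit.smul_apply]
    congr 2
    ext ε
    have := hU _ hδ (γ * ε)
    simpa [mul_assoc] using this.symm

open Classical in
/-- The base point of the ambit. -/
noncomputable def Ambit.base : Ambit Γ := fun A => decide ((1 : Γ) ∈ A.1)

theorem Ambit.smul_base_apply (γ : Γ) (A : leftUniformSets Γ) :
    (γ • (Ambit.base : Ambit Γ)) A = true ↔ γ ∈ A.1 := by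
  rw [Ambit.smul_apply]
  simp [Ambit.base]

/-- A continuous function exists along a closed relation which is a graph. -/
theorem exists_continuous_of_closed_graph {X Y : Type*} [TopologicalSpace X] [TopologicalSpace Y]
    [CompactSpace Y] (R : Set (X × Y)) (hR : IsClosed R) (f : X → Y)
    (hf : ∀ x y, (x, y) ∈ R ↔ y = f x) : Continuous f := by
  rw [continuous_iff_isClosed]
  intro s hs
  have : f ⁻¹' s = Prod.fst '' (R ∩ (univ ×ˢ s)) := by
    ext x
    simp [hf]
  rw [this]
  exact isClosedMap_fst_of_compactSpace _ (hR.inter (isClosed_univ.prod hs))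

/-- The orbit closure of `(Ambit.base, y)` is the graph of a map over the orbit closure of
`Ambit.base`. The clause on clopen sets says that the map extends `γ ↦ γ • y` in the sense of Stone
duality. -/
theorem Ambit.exists_map {Y : Type*} [TopologicalSpace Y] [CompactSpace Y] [T2Space Y]
    [MulAction Γ Y] [ContinuousSMul Γ Y] (y : Y) (Z : SubMulAction Γ (Ambit Γ))
    (hZ : (Z : Set (Ambit Γ)) ⊆ closure (MulAction.orbit Γ Ambit.base)) :
    ∃ f : Z → Y, IsFlowMap Γ f ∧ ∀ V : Set Y, IsClopen V →
      ∀ hA : {γ : Γ | γ • y ∈ V} ∈ leftUniformSets Γ,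
      ∀ p : Z, f p ∈ V ↔ p.1 ⟨{γ : Γ | γ • y ∈ V}, hA⟩ = true := by
  set R : Set (Ambit Γ × Y) := closure (MulAction.orbit Γ (Ambit.base, y)) with hR
  have hRi : ∀ (γ : Γ), ∀ q ∈ R, γ • q ∈ R := fun γ q hq =>
    smul_closure_orbit_subset γ _ ⟨q, hq, rfl⟩
  have hex : ∀ p ∈ closure (MulAction.orbit Γ (Ambit.base : Ambit Γ)), ∃ z, (p, z) ∈ R := by
    have hcl : IsClosed (Prod.fst '' R) := isClosedMap_fst_of_compactSpace _ isClosed_closure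
    have : closure (MulAction.orbit Γ (Ambit.base : Ambit Γ)) ⊆ Prod.fst '' R := by
      refine closure_minimal ?_ hcl
      rintro _ ⟨γ, rfl⟩
      exact ⟨γ • (Ambit.base, y), subset_closure ⟨γ, rfl⟩, rfl⟩
    intro p hp
    obtain ⟨⟨p', z⟩, hz, rfl⟩ := this hp
    exact ⟨z, hz⟩
  have huniq : ∀ p z₁ z₂, (p, z₁) ∈ R → (p, z₂) ∈ R → z₁ = z₂ := by
    intro p z₁ z₂ h₁ h₂
    by_contra hne
    obtain ⟨O₁, O₂, hO₁, hO₂, hz₁, hz₂, hdisj⟩ := t2_separation hne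
    have hcont : ContinuousAt (fun q : Γ × Y => q.1 • q.2) (1, z₁) := continuous_smul.continuousAt
    have hmem : ∀ᶠ q : Γ × Y in 𝓝 (1, z₁), q.1 • q.2 ∈ O₁ :=
      hcont.eventually_mem (hO₁.mem_nhds (by simpa using hz₁))
    rw [nhds_prod_eq, eventually_prod_iff] at hmem
    obtain ⟨P, hP, P', hP', hPP⟩ := hmem
    obtain ⟨U, hU⟩ := NonarchimedeanGroup.is_nonarchimedean _ hP
    -- Saturating by `U` makes this set uniform, and it still sends `y` into `O₁` because `U` moves
    -- `P'` into `O₁`. The coordinate of `p` at `A` is locally constant, so group elements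
    -- approximating `(p, z₁)` and `(p, z₂)` must agree on membership in `A`.
    let A : Set Γ := {γ | ∃ u ∈ U, P' ((u * γ) • y)}
    have hA : A ∈ leftUniformSets Γ := by
      refine ⟨U, fun u hu γ => ⟨?_, ?_⟩⟩
      · rintro ⟨w, hw, h⟩
        exact ⟨w * u, U.mul_mem hw hu, by simpa [mul_assoc] using h⟩
      · rintro ⟨w, hw, h⟩
        exact ⟨w * u⁻¹, U.mul_mem hw (U.inv_mem hu), by simpa [mul_assoc] using h⟩
    have hAO : ∀ γ ∈ A, γ • y ∈ O₁ := by
      rintro γ ⟨u, hu, h⟩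
      have := hPP (hU (U.inv_mem hu)) h
      simpa [smul_smul] using this
    have hcA : ∀ᶠ q : Ambit Γ × Y in 𝓝 (p, z₁), q.1 ⟨A, hA⟩ = p ⟨A, hA⟩ := by
      have : Continuous fun q : Ambit Γ × Y => q.1 ⟨A, hA⟩ :=
        (Ambit.continuous_apply _).comp continuous_fst
      exact this.continuousAt.eventually_mem (mem_nhds_discrete.2 (mem_singleton _))
    have hcA' : ∀ᶠ q : Ambit Γ × Y in 𝓝 (p, z₂), q.1 ⟨A, hA⟩ = p ⟨A, hA⟩ := by
      have : Continuous fun q : Ambit Γ × Y => q.1 ⟨A, hA⟩ :=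
        (Ambit.continuous_apply _).comp continuous_fst
      exact this.continuousAt.eventually_mem (mem_nhds_discrete.2 (mem_singleton _))
    have e₁ : ∀ᶠ q : Ambit Γ × Y in 𝓝 (p, z₁), P' q.2 := continuous_snd.continuousAt.eventually hP'
    have e₂ : ∀ᶠ q : Ambit Γ × Y in 𝓝 (p, z₂), q.2 ∈ O₂ :=
      continuous_snd.continuousAt.eventually (hO₂.mem_nhds hz₂)
    obtain ⟨_, ⟨hq1, hq2⟩, γ, rfl⟩ := mem_closure_iff_nhds.1 h₁ _ (hcA.and e₁)
    obtain ⟨_, ⟨hr1, hr2⟩, δ, rfl⟩ := mem_closure_iff_nhds.1 h₂ _ (hcA'.and e₂)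
    have hγ : γ ∈ A := ⟨1, U.one_mem, by simpa using hq2⟩
    have h3 : p ⟨A, hA⟩ = true := by
      rw [← hq1]; exact (Ambit.smul_base_apply γ ⟨A, hA⟩).2 hγ
    have h4 : δ ∈ A := (Ambit.smul_base_apply δ ⟨A, hA⟩).1 (hr1.trans h3)
    exact disjoint_left.1 hdisj (hAO δ h4) hr2
  choose f hf using fun p : Z => hex p.1 (hZ p.2)
  have hfc : Continuous f := by
    refine exists_continuous_of_closed_graph {q : Z × Y | (q.1.1, q.2) ∈ R}
      (isClosed_closure.preimage (by fun_prop)) f fun x z => ⟨fun h => huniq _ _ _ h (hf x), ?_⟩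
    rintro rfl
    exact hf x
  refine ⟨f, ⟨hfc, fun γ p => huniq _ _ _ (hf _) (hRi γ _ (hf p))⟩, ?_⟩
  intro V hV hA p
  -- The equivalence is a closed condition that holds along the orbit, so it holds on its closure.
  have hcl : IsClosed {q : Ambit Γ × Y | q.2 ∈ V ↔ q.1 ⟨_, hA⟩ = true} := by
    have h1 : IsClopen {q : Ambit Γ × Y | q.2 ∈ V} := hV.preimage continuous_snd
    have h2 : IsClopen {q : Ambit Γ × Y | q.1 ⟨_, hA⟩ = true} :=
      (isClopen_discrete {true}).preimage
        ((Ambit.continuous_apply ⟨_, hA⟩).comp continuous_fst)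
    have : {q : Ambit Γ × Y | q.2 ∈ V ↔ q.1 ⟨_, hA⟩ = true} =
        ({q : Ambit Γ × Y | q.2 ∈ V} ∩ {q | q.1 ⟨_, hA⟩ = true}) ∪
        ({q : Ambit Γ × Y | q.2 ∈ V}ᶜ ∩ {q | q.1 ⟨_, hA⟩ = true}ᶜ) := by
      ext q
      by_cases h : q.2 ∈ V <;> simp [h]
    rw [this]
    exact ((h1.inter h2).union (h1.compl.inter h2.compl)).1
  have hsub : R ⊆ {q : Ambit Γ × Y | q.2 ∈ V ↔ q.1 ⟨_, hA⟩ = true} := by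
    refine closure_minimal ?_ hcl
    rintro _ ⟨γ, rfl⟩
    exact (Ambit.smul_base_apply γ ⟨{γ : Γ | γ • y ∈ V}, hA⟩).symm
  exact hsub (hf p)

end Core

section FiniteTypes

/-! ### Finiteness of the algebras of invariant clopen sets -/

/-- Some `B` cuts `A` into two parts with nonempty images, since otherwise the only traces would be
`∅` and `h A`. The traces on one of the parts are infinite; the other part is split off. -/
theorem exists_subset_of_infinite_traces {D X : Type*} (h : Set D → Set X)
    (hinter : ∀ A B, h (A ∩ B) = h A ∩ h B) (hcompl : ∀ A, h Aᶜ = (h A)ᶜ) (A : Set D)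
    (hA : (range fun B => h (B ∩ A)).Infinite) :
    ∃ A₁ ⊆ A, (h A₁).Nonempty ∧ (range fun B => h (B ∩ (A \ A₁))).Infinite := by
  have hdiff : ∀ A B, h (A \ B) = h A \ h B := fun A B => by
    rw [Set.sdiff_eq, hinter, hcompl, Set.sdiff_eq]
  obtain ⟨B, hB₁, hB₂⟩ : ∃ B, (h (A ∩ B)).Nonempty ∧ (h (A \ B)).Nonempty := by
    by_contra! hcon
    refine hA (Set.Finite.subset (Set.toFinite {∅, h A}) ?_)
    rintro _ ⟨B, rfl⟩
    by_cases hn : (h (A ∩ B)).Nonempty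
    · right
      have h1 := hcon B hn
      rw [hdiff, Set.sdiff_eq_empty] at h1
      change h (B ∩ A) = h A
      rw [hinter, inter_eq_right.2 h1]
    · left
      change h (B ∩ A) = ∅
      rw [inter_comm]
      exact not_nonempty_iff_eq_empty.1 hn
  by_cases hbig : (range fun C => h (C ∩ (A \ B))).Infinite
  · refine ⟨A ∩ B, inter_subset_left, hB₁, ?_⟩
    rwa [Set.sdiff_self_inter]
  · refine ⟨A \ B, sdiff_subset, hB₂, fun hfin => hA ?_⟩
    refine ((hfin.image2 (· ∪ ·) (not_infinite.1 hbig))).subset ?_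
    rintro _ ⟨C, rfl⟩
    refine ⟨_, ⟨C, rfl⟩, _, ⟨C, rfl⟩, ?_⟩
    simp only [hinter, hdiff]
    ext x
    simp only [mem_union, mem_inter_iff, Set.mem_sdiff]
    tauto

/-- A homomorphic image of a power set algebra, in a power set algebra, is finite if it is
countable. -/
theorem finite_range_of_countable_range {D X : Type*} (h : Set D → Set X)
    (hinter : ∀ A B, h (A ∩ B) = h A ∩ h B) (hcompl : ∀ A, h Aᶜ = (h A)ᶜ)
    (hc : (range h).Countable) : (range h).Finite := by
  by_contra hinf
  have h0 : (range fun B => h (B ∩ univ)).Infinite := by simpa using hinf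
  choose! T hTsub hTne hTbig using exists_subset_of_infinite_traces h hinter hcompl
  -- Repeated splitting gives disjoint sets `T (S n)` with nonempty images.
  let S : ℕ → Set D := Nat.rec univ fun _ s => s \ T s
  have hS : ∀ n, S (n + 1) = S n \ T (S n) := fun n => rfl
  have hbig : ∀ n, (range fun B => h (B ∩ S n)).Infinite := by
    intro n
    induction n with
    | zero => exact h0
    | succ n ih => rw [hS]; exact hTbig _ ih
  have hanti : Antitone S := antitone_nat_of_succ_le fun n => by rw [hS]; exact sdiff_subset
  have hdisj : ∀ m n, m < n → Disjoint (T (S m)) (T (S n)) := by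
    intro m n hmn
    have h1 : T (S n) ⊆ S m \ T (S m) :=
      (hTsub _ (hbig n)).trans ((hanti (Nat.succ_le_of_lt hmn)).trans (hS m).subset)
    exact (disjoint_sdiff_left.mono_left h1).symm
  have hdisj' : ∀ m n, m ≠ n → Disjoint (T (S m)) (T (S n)) := by
    intro m n hmn
    rcases lt_or_gt_of_ne hmn with h | h
    · exact hdisj m n h
    · exact (hdisj n m h).symm
  have hmono : ∀ A B, A ⊆ B → h A ⊆ h B := fun A B hAB => by
    rw [← inter_eq_left.2 hAB, hinter]
    exact inter_subset_right
  have hempty : h ∅ = ∅ := by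
    have h1 := hinter ∅ ∅ᶜ
    rwa [hcompl, inter_compl_self, inter_compl_self] at h1
  -- The domain is a full power set, so all unions of the pieces are available; their images are
  -- distinct, which puts a copy of `Set ℕ` in a countable range.
  have hinj : Function.Injective fun I : Set ℕ => h (⋃ i ∈ I, T (S i)) := by
    have key : ∀ I J : Set ℕ, h (⋃ i ∈ I, T (S i)) = h (⋃ i ∈ J, T (S i)) → I ⊆ J := by
      intro I J hIJ n hn
      by_contra hnJ
      obtain ⟨x, hx⟩ := hTne _ (hbig n)
      have h1 : x ∈ h (⋃ i ∈ I, T (S i)) := hmono _ _ (subset_biUnion_of_mem hn) hx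
      rw [hIJ] at h1
      have h2 : T (S n) ∩ (⋃ i ∈ J, T (S i)) = ∅ := by
        rw [← disjoint_iff_inter_eq_empty, disjoint_iUnion₂_right]
        exact fun i hi => hdisj' n i (by rintro rfl; exact hnJ hi)
      have h3 : x ∈ h (T (S n) ∩ (⋃ i ∈ J, T (S i))) := by rw [hinter]; exact ⟨hx, h1⟩
      rw [h2, hempty] at h3
      exact h3
    intro I J hIJ
    exact (key I J hIJ).antisymm (key J I hIJ.symm)
  have := hc.to_subtype
  have hcount : Countable (Set ℕ) :=
    Function.Injective.countable (β := range h)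
      (f := fun I : Set ℕ => ⟨h (⋃ i ∈ I, T (S i)), mem_range_self _⟩)
      fun I J hIJ => hinj (Subtype.ext_iff.1 hIJ)
  obtain ⟨f, hf⟩ := exists_surjective_nat (Set ℕ)
  exact Function.cantor_surjective f hf

variable {Γ : Type u} [Group Γ]

/-- The algebra of the clopen sets that are invariant under a subgroup. -/
def invClopens (N : Type*) [TopologicalSpace N] [MulAction Γ N] (U : Subgroup Γ) : Set (Set N) :=
  {V | IsClopen V ∧ ∀ u ∈ U, ∀ x, u • x ∈ V ↔ x ∈ V}

variable [TopologicalSpace Γ] [NonarchimedeanGroup Γ]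

/-- A set of cosets of `U` defines a clopen subset of `Z`, and this is a Boolean homomorphism with
countable, hence finite, image. A surjective self-map of `Z` pulls every invariant clopen set back
into that image. -/
theorem finite_invClopens_of_countable_clopens (Z : SubMulAction Γ (Ambit Γ))
    [CompactSpace Z] [Nonempty Z] [MulAction.IsMinimal Γ Z]
    (hZ : (Z : Set (Ambit Γ)) ⊆ closure (MulAction.orbit Γ Ambit.base))
    (hc : {V : Set Z | IsClopen V}.Countable) (U : OpenSubgroup Γ) :
    (invClopens Z (U : Subgroup Γ)).Finite := by
  let D := Quotient (QuotientGroup.rightRel (U : Subgroup Γ))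
  let π : Γ → D := fun γ => Quotient.mk _ γ
  have hπ : ∀ u ∈ U, ∀ γ, π (u * γ) = π γ := fun u hu γ => by
    refine Quotient.sound (QuotientGroup.rightRel_apply.2 ?_)
    simpa using U.inv_mem hu
  have hmem : ∀ A : Set D, π ⁻¹' A ∈ leftUniformSets Γ := fun A =>
    ⟨U, fun u hu γ => by rw [mem_preimage, mem_preimage, hπ u hu γ]⟩
  let h : Set D → Set Z := fun A => {p | p.1 ⟨π ⁻¹' A, hmem A⟩ = true}
  -- On finitely many coordinates `p` looks like evaluation at a group element, so Boolean
  -- identities for `h` can be checked there.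
  have hnear : ∀ (p : Z) (A B C : Set D), ∃ γ : Γ,
      (π γ ∈ A ↔ p ∈ h A) ∧ (π γ ∈ B ↔ p ∈ h B) ∧ (π γ ∈ C ↔ p ∈ h C) := by
    intro p A B C
    have hev : ∀ A : Set D, ∀ᶠ q : Ambit Γ in 𝓝 p.1, q ⟨_, hmem A⟩ = p.1 ⟨_, hmem A⟩ := fun A =>
      (Ambit.continuous_apply ⟨_, hmem A⟩).continuousAt.eventually_mem
        (mem_nhds_discrete.2 (mem_singleton _))
    obtain ⟨_, ⟨h1, h2, h3⟩, γ, rfl⟩ := mem_closure_iff_nhds.1 (hZ p.2) _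
      ((hev A).and ((hev B).and (hev C)))
    refine ⟨γ, ?_, ?_, ?_⟩
    · rw [← mem_preimage, ← Ambit.smul_base_apply γ ⟨_, hmem A⟩]
      exact Eq.congr_left h1
    · rw [← mem_preimage, ← Ambit.smul_base_apply γ ⟨_, hmem B⟩]
      exact Eq.congr_left h2
    · rw [← mem_preimage, ← Ambit.smul_base_apply γ ⟨_, hmem C⟩]
      exact Eq.congr_left h3
  have hinter : ∀ A B, h (A ∩ B) = h A ∩ h B := by
    intro A B
    ext p
    obtain ⟨γ, h1, h2, h3⟩ := hnear p A B (A ∩ B)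
    rw [mem_inter_iff, ← h1, ← h2, ← h3, mem_inter_iff]
  have hcompl : ∀ A, h Aᶜ = (h A)ᶜ := by
    intro A
    ext p
    obtain ⟨γ, h1, h2, -⟩ := hnear p A Aᶜ A
    rw [mem_compl_iff, ← h1, ← h2, mem_compl_iff]
  have hclopen : ∀ A, IsClopen (h A) := fun A =>
    (isClopen_discrete {true}).preimage
      ((Ambit.continuous_apply ⟨_, hmem A⟩).comp continuous_subtype_val)
  have hfin : (range h).Finite := finite_range_of_countable_range h hinter hcompl
    (hc.mono (range_subset_iff.2 hclopen))
  obtain ⟨q⟩ := ‹Nonempty Z›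
  -- This extends the orbit map `γ ↦ γ • q`. For `V` invariant under `U`, the set of `γ` with `γ • q
  -- ∈ V` is a union of cosets, so `f ⁻¹' V` is a value of `h`.
  obtain ⟨f, hf, hfV⟩ := Ambit.exists_map q Z hZ
  have : Nonempty Z := ⟨q⟩
  have hsurj := hf.surjective
  refine Set.Finite.of_finite_image (hfin.subset ?_) (hsurj.preimage_injective.injOn)
  rintro _ ⟨V, hV, rfl⟩
  have hset : {γ : Γ | γ • q ∈ V} = π ⁻¹' (π '' {γ : Γ | γ • q ∈ V}) := by
    refine (subset_preimage_image _ _).antisymm ?_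
    rintro γ ⟨δ, hδ, hγδ⟩
    have h1 : γ * δ⁻¹ ∈ (U : Subgroup Γ) := QuotientGroup.rightRel_apply.1 (Quotient.exact hγδ)
    have h2 := (hV.2 _ h1 (δ • q)).2 hδ
    simpa [smul_smul] using h2
  have hA : {γ : Γ | γ • q ∈ V} ∈ leftUniformSets Γ := by rw [hset]; exact hmem _
  refine ⟨π '' {γ : Γ | γ • q ∈ V}, ?_⟩
  ext p
  change p.1 ⟨_, _⟩ = true ↔ f p ∈ V
  rw [hfV V hV.1 hA p]
  congr! 3
  exact hset.symm

theorem countable_clopens {X : Type*} [TopologicalSpace X] [CompactSpace X]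
    [SecondCountableTopology X] : {V : Set X | IsClopen V}.Countable := by
  have h : ∀ V : {V : Set X | IsClopen V}, ∃ t : Finset (TopologicalSpace.countableBasis X),
      V.1 = (SetLike.coe t).sUnion := fun V =>
    eq_sUnion_finset_of_isTopologicalBasis_of_isCompact_open _
      (TopologicalSpace.isBasis_countableBasis X) V.1 V.2.1.isCompact V.2.2
  choose f hf using h
  have hinj : Function.Injective f := fun V W hVW => Subtype.ext (by rw [hf V, hf W, hVW])
  exact hinj.countable

theorem countable_clopens_of_surjective {X Y : Type*} [TopologicalSpace X] [TopologicalSpace Y]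
    {f : X → Y} (hf : Continuous f) (hs : Function.Surjective f)
    (h : {V : Set X | IsClopen V}.Countable) : {V : Set Y | IsClopen V}.Countable :=
  Set.MapsTo.countable_of_injOn (f := preimage f) (fun _ hV => hV.preimage hf)
    hs.preimage_injective.injOn h

end FiniteTypes

section Consequences

/-! ### Flows with finitely many types -/

variable {Γ : Type u} [Group Γ] [TopologicalSpace Γ]

/-- A minimal flow on a profinite space that maps to every flow, and that has only finitely many
clopen sets invariant under any given open subgroup. -/
structure HasFiniteTypes (Γ : Type u) [Group Γ] [TopologicalSpace Γ] (N : Type u)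
    [TopologicalSpace N] [MulAction Γ N] : Prop where
  compact : CompactSpace N
  hausdorff : T2Space N
  totallyDisconnected : TotallyDisconnectedSpace N
  nonempty : Nonempty N
  continuousSMul : ContinuousSMul Γ N
  minimal : MulAction.IsMinimal Γ N
  finite : ∀ U : OpenSubgroup Γ, (invClopens N (U : Subgroup Γ)).Finite
  lift : ∀ (Y : Type u) [TopologicalSpace Y] [MulAction Γ Y] [CompactSpace Y] [T2Space Y]
    [ContinuousSMul Γ Y] [Nonempty Y], ∃ f : N → Y, IsFlowMap Γ f

/-- Two points are of the same type over `U` if no `U`-invariant clopen set separates them. -/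
def SameType {N : Type*} [TopologicalSpace N] [MulAction Γ N] (U : Subgroup Γ) (x y : N) : Prop :=
  ∀ V ∈ invClopens N U, x ∈ V ↔ y ∈ V

section Basic

variable {N : Type*} [TopologicalSpace N] [MulAction Γ N] {U : Subgroup Γ} {x y z : N}

theorem SameType.refl (U : Subgroup Γ) (x : N) : SameType U x x := fun _ _ => Iff.rfl

theorem SameType.symm (h : SameType U x y) : SameType U y x := fun V hV => (h V hV).symm

theorem SameType.trans (h : SameType U x y) (h' : SameType U y z) : SameType U x z :=
  fun V hV => (h V hV).trans (h' V hV)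

theorem invClopens_mono {U W : Subgroup Γ} (h : U ≤ W) : invClopens N W ⊆ invClopens N U :=
  fun _ hV => ⟨hV.1, fun u hu => hV.2 u (h hu)⟩

theorem SameType.mono {U W : Subgroup Γ} (h : U ≤ W) (hxy : SameType U x y) : SameType W x y :=
  fun V hV => hxy V (invClopens_mono h hV)

theorem sameType_smul {u : Γ} (hu : u ∈ U) (x : N) : SameType U (u • x) x :=
  fun _ hV => hV.2 u hu x

theorem preimage_smul_mem_invClopens [ContinuousConstSMul Γ N] {V : Set N} {U W : Subgroup Γ}
    (hV : V ∈ invClopens N U) (γ : Γ) (h : ∀ w ∈ W, γ * w * γ⁻¹ ∈ U) :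
    {x | γ • x ∈ V} ∈ invClopens N W := by
  refine ⟨hV.1.preimage (continuous_const_smul γ), fun w hw x => ?_⟩
  have := hV.2 _ (h w hw) (γ • x)
  simpa [smul_smul] using this

/-- Translating a pair of points of the same type. -/
theorem SameType.smul [ContinuousConstSMul Γ N] {U W : Subgroup Γ} (hxy : SameType W x y) (γ : Γ)
    (h : ∀ w ∈ W, γ * w * γ⁻¹ ∈ U) : SameType U (γ • x) (γ • y) := fun V hV =>
  hxy {x | γ • x ∈ V} (preimage_smul_mem_invClopens hV γ h)

theorem isClopen_setOf_sameType (hfin : (invClopens N U).Finite) (x : N) :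
    {y | SameType U x y} ∈ invClopens N U := by
  have : {y | SameType U x y} = ⋂ V ∈ invClopens N U, {y | x ∈ V ↔ y ∈ V} := by
    ext y
    simp [SameType]
  refine ⟨?_, fun u hu y => ⟨fun h => h.trans (sameType_smul hu y),
    fun h => h.trans (sameType_smul hu y).symm⟩⟩
  rw [this]
  refine hfin.isClopen_biInter fun V hV => ?_
  by_cases hx : x ∈ V
  · simpa [hx] using hV.1
  · simp only [hx, false_iff]
    exact hV.1.compl

end Basic

variable [NonarchimedeanGroup Γ]

/-- By the tube lemma on the compact set `V`, elements near the identity map `V` into itself; the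
inverses in a subgroup give the converse. -/
theorem exists_openSubgroup_mem_invClopens {N : Type*} [TopologicalSpace N] [MulAction Γ N]
    [CompactSpace N] [ContinuousSMul Γ N] {V : Set N} (hV : IsClopen V) :
    ∃ U : OpenSubgroup Γ, V ∈ invClopens N (U : Subgroup Γ) := by
  have hopen : IsOpen {q : Γ × N | q.1 • q.2 ∈ V} := hV.2.preimage continuous_smul
  obtain ⟨O, P, hO, hP, h1O, hVP, hOP⟩ := generalized_tube_lemma (isCompact_singleton (x := (1 : Γ)))
    hV.1.isCompact hopen (by rintro ⟨γ, x⟩ ⟨rfl, hx⟩; simpa using hx)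
  obtain ⟨U, hU⟩ := NonarchimedeanGroup.is_nonarchimedean O (hO.mem_nhds (h1O rfl))
  have key : ∀ u ∈ U, ∀ x ∈ V, u • x ∈ V := fun u hu x hx =>
    @hOP (u, x) ⟨hU hu, hVP hx⟩
  refine ⟨U, hV, fun u hu x => ⟨fun h => ?_, key u hu x⟩⟩
  simpa using key u⁻¹ (U.inv_mem hu) _ h

/-- The flow of the two-valued functions on the group that are invariant under left translation by
elements of `U`. -/
def Colorings (U : Subgroup Γ) : Type u := {c : Γ → Bool // ∀ u ∈ U, ∀ γ, c (u * γ) = c γ}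

namespace Colorings

variable (U : OpenSubgroup Γ)

instance : TopologicalSpace (Colorings (U : Subgroup Γ)) :=
  inferInstanceAs (TopologicalSpace {c : Γ → Bool // ∀ u ∈ (U : Subgroup Γ), ∀ γ, c (u * γ) = c γ})

instance : T2Space (Colorings (U : Subgroup Γ)) :=
  inferInstanceAs (T2Space {c : Γ → Bool // ∀ u ∈ (U : Subgroup Γ), ∀ γ, c (u * γ) = c γ})

instance : CompactSpace (Colorings (U : Subgroup Γ)) := by
  refine isCompact_iff_compactSpace.1 (IsClosed.isCompact ?_)
  have : {c : Γ → Bool | ∀ u ∈ (U : Subgroup Γ), ∀ γ, c (u * γ) = c γ} =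
      ⋂ u ∈ (U : Subgroup Γ), ⋂ γ, {c | c (u * γ) = c γ} := by
    ext c
    simp
  change IsClosed {c : Γ → Bool | ∀ u ∈ (U : Subgroup Γ), ∀ γ, c (u * γ) = c γ}
  rw [this]
  exact isClosed_biInter fun u _ => isClosed_iInter fun γ =>
    isClosed_eq (continuous_apply _) (continuous_apply _)

instance : MulAction Γ (Colorings (U : Subgroup Γ)) where
  smul δ c := ⟨fun γ => c.1 (γ * δ), fun u hu γ => by
    change c.1 (u * γ * δ) = c.1 (γ * δ)
    rw [mul_assoc]
    exact c.2 u hu _⟩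
  one_smul c := Subtype.ext (funext fun γ => congrArg c.1 (mul_one γ))
  mul_smul δ₁ δ₂ c := Subtype.ext (funext fun γ => congrArg c.1 (mul_assoc γ δ₁ δ₂).symm)

theorem smul_apply (δ γ : Γ) (c : Colorings (U : Subgroup Γ)) : (δ • c).1 γ = c.1 (γ * δ) := rfl

theorem continuous_eval (γ : Γ) : Continuous fun c : Colorings (U : Subgroup Γ) => c.1 γ :=
  (continuous_apply γ).comp continuous_subtype_val

instance : ContinuousSMul Γ (Colorings (U : Subgroup Γ)) where
  continuous_smul := by
    refine Continuous.subtype_mk (continuous_pi fun γ => continuous_iff_continuousAt.2 ?_) _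
    rintro ⟨δ, c⟩
    have h1 : ContinuousAt (fun q : Γ × Colorings (U : Subgroup Γ) => q.2.1 (γ * δ)) (δ, c) :=
      ((continuous_eval U _).comp continuous_snd).continuousAt
    refine h1.congr ?_
    have hc : Continuous fun ε : Γ => γ * ε * (γ * δ)⁻¹ := by fun_prop
    have hev : ∀ᶠ ε in 𝓝 δ, γ * ε * (γ * δ)⁻¹ ∈ (U : Set Γ) :=
      hc.continuousAt.eventually_mem (U.isOpen.mem_nhds (by simp))
    filter_upwards [continuous_fst.continuousAt.eventually hev]
    rintro ⟨ε, d⟩ (hε : γ * ε * (γ * δ)⁻¹ ∈ (U : Subgroup Γ))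
    change d.1 (γ * δ) = d.1 (γ * ε)
    rw [← d.2 _ hε (γ * δ)]
    group

end Colorings

/-! ### Coalescence, limit colourings and amalgamation -/

namespace HasFiniteTypes

variable {N : Type u} [TopologicalSpace N] [MulAction Γ N] (hN : HasFiniteTypes Γ N)
include hN

theorem eq_of_forall_isClopen {x y : N} (h : ∀ V : Set N, IsClopen V → x ∈ V → y ∈ V) : x = y := by
  have := hN.compact
  have := hN.hausdorff
  have := hN.totallyDisconnected
  by_contra hne
  obtain ⟨V, hV, hxV, hVy⟩ := compact_exists_isClopen_in_isOpen (isOpen_compl_singleton (x := y))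
    (x := x) hne
  exact hVy (h V hV hxV) rfl

theorem eq_of_sameType {x y : N} (h : ∀ U : OpenSubgroup Γ, SameType (U : Subgroup Γ) x y) :
    x = y := by
  have := hN.compact
  have := hN.continuousSMul
  refine hN.eq_of_forall_isClopen fun V hV hx => ?_
  obtain ⟨U, hU⟩ := exists_openSubgroup_mem_invClopens (Γ := Γ) hV
  exact (h U V hU).1 hx

theorem setOf_sameType_mem_nhds (U : OpenSubgroup Γ) (x : N) :
    {y | SameType (U : Subgroup Γ) x y} ∈ 𝓝 x :=
  (isClopen_setOf_sameType (hN.finite U) x).1.2.mem_nhds (SameType.refl _ x)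

theorem exists_smul_sameType (U : OpenSubgroup Γ) (x y : N) :
    ∃ γ : Γ, SameType (U : Subgroup Γ) x (γ • y) := by
  have := hN.minimal
  obtain ⟨γ, hγ⟩ := (isClopen_setOf_sameType (hN.finite U) x).1.2.exists_smul_mem Γ y
    ⟨x, SameType.refl _ x⟩
  exact ⟨γ, hγ⟩

/-- `f` is surjective, so preimage under `f` is an injective self-map of the finite algebra of
`U`-invariant clopen sets, hence onto. Every clopen set is thus a preimage under `f`, and clopen
sets separate points. -/
theorem injective_of_isFlowMap {f : N → N} (hf : IsFlowMap Γ f) : Function.Injective f := by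
  have := hN.compact
  have := hN.hausdorff
  have := hN.nonempty
  have := hN.minimal
  have := hN.continuousSMul
  intro x y hxy
  refine hN.eq_of_forall_isClopen fun V hV hx => ?_
  obtain ⟨U, hU⟩ := exists_openSubgroup_mem_invClopens (Γ := Γ) hV
  have hmaps : MapsTo (preimage f) (invClopens N (U : Subgroup Γ))
      (invClopens N (U : Subgroup Γ)) :=
    fun W hW => ⟨hW.1.preimage hf.1, fun u hu x => by
      rw [mem_preimage, hf.2]; exact hW.2 _ hu (f x)⟩
  obtain ⟨W, -, rfl⟩ := ((hN.finite U).injOn_iff_bijOn_of_mapsTo hmaps).1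
    hf.surjective.preimage_injective.injOn |>.surjOn hU
  rwa [mem_preimage, ← hxy]

/-- `N` maps to the flow `Q`. The first coordinate of that map is a self-map of `N`, hence a
homeomorphism, and composing with its inverse turns the map into a section. -/
theorem exists_section {Y : Type u} [TopologicalSpace Y] [MulAction Γ Y] [CompactSpace Y]
    [T2Space Y] [ContinuousSMul Γ Y] (Q : Set (N × Y)) (hQ : IsClosed Q) (hQn : Q.Nonempty)
    (hQi : ∀ γ : Γ, ∀ q ∈ Q, γ • q ∈ Q) :
    ∃ τ : N → Y, IsFlowMap Γ τ ∧ ∀ x, (x, τ x) ∈ Q := by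
  have := hN.compact
  have := hN.hausdorff
  have := hN.nonempty
  have := hN.minimal
  have := hN.continuousSMul
  have : CompactSpace (subflow Q hQi) := isCompact_iff_compactSpace.1 hQ.isCompact
  have : Nonempty (subflow Q hQi) := hQn.to_subtype
  obtain ⟨f, hf⟩ := hN.lift (subflow Q hQi)
  let g : N → N := fun x => (f x).1.1
  have hg : IsFlowMap Γ g :=
    ⟨continuous_fst.comp (continuous_subtype_val.comp hf.1), fun γ x => by simp [g, hf.2]⟩
  have hbij : Function.Bijective g := ⟨hN.injective_of_isFlowMap hg, hg.surjective⟩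
  let e : N ≃ₜ N := Continuous.homeoOfEquivCompactToT2 (f := Equiv.ofBijective g hbij) hg.1
  have he : ∀ x, g (e.symm x) = x := fun x => e.apply_symm_apply x
  refine ⟨fun x => (f (e.symm x)).1.2, ⟨continuous_snd.comp (continuous_subtype_val.comp
    (hf.1.comp e.symm.continuous)), fun γ x => ?_⟩, fun x => ?_⟩
  · have h1 : e.symm (γ • x) = γ • e.symm x := by
      apply hbij.1
      rw [he, hg.2, he]
    change (f (e.symm (γ • x))).1.2 = _
    rw [h1, hf.2]
    rfl
  · have h1 := (f (e.symm x)).2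
    have h2 : (f (e.symm x)).1 = (x, (f (e.symm x)).1.2) := Prod.ext (he x) rfl
    rw [h2] at h1
    exact h1

/-- Every two-colouring of the cosets of `U` has, in the limit, a translate which is given by a
single invariant clopen set. -/
theorem exists_limit_coloring (U : OpenSubgroup Γ) (x : N) (A : Set Γ)
    (hA : ∀ u ∈ U, ∀ γ, u * γ ∈ A ↔ γ ∈ A) :
    ∃ V ∈ invClopens N (U : Subgroup Γ), ∀ y, ∀ O ∈ 𝓝 y, ∀ E : Set Γ, E.Finite →
      ∃ δ : Γ, δ • x ∈ O ∧ ∀ γ ∈ E, γ * δ ∈ A ↔ γ • y ∈ V := by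
  classical
  have := hN.continuousSMul
  let c : Colorings (U : Subgroup Γ) := ⟨fun γ => decide (γ ∈ A), fun u hu γ => by
    simp [hA u hu γ]⟩
  obtain ⟨τ, hτ, hτQ⟩ := hN.exists_section (closure (MulAction.orbit Γ (x, c))) isClosed_closure
    (MulAction.nonempty_orbit _).closure
    (fun γ q hq => smul_closure_orbit_subset γ _ ⟨q, hq, rfl⟩)
  -- By equivariance the whole colouring `τ y` is read off from the value at `1` along the orbit of
  -- `y`.
  have hτ1 : ∀ γ y, (τ y).1 γ = (τ (γ • y)).1 1 := fun γ y => by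
    rw [hτ.2, Colorings.smul_apply, one_mul]
  refine ⟨{y | (τ y).1 1 = true}, ⟨(isClopen_discrete {true}).preimage
    ((Colorings.continuous_eval U 1).comp hτ.1), fun u hu y => ?_⟩, fun y O hO E hE => ?_⟩
  · change (τ (u • y)).1 1 = true ↔ (τ y).1 1 = true
    rw [← hτ1, ← (τ y).2 u hu 1, mul_one]
  · have hev : ∀ᶠ q : N × Colorings (U : Subgroup Γ) in 𝓝 (y, τ y),
        q.1 ∈ O ∧ ∀ γ ∈ E, q.2.1 γ = (τ y).1 γ := by
      refine (continuous_fst.continuousAt.eventually_mem hO).and ((hE.eventually_all).2 ?_)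
      intro γ _
      exact ((Colorings.continuous_eval U γ).comp continuous_snd).continuousAt.eventually_mem
        (mem_nhds_discrete.2 (mem_singleton _))
    -- `(y, τ y)` is a limit of translates of `(x, c)`, so one `δ` both moves `x` near `y` and makes
    -- `δ • c` agree with `τ y` on `E`.
    obtain ⟨_, ⟨h1, h2⟩, δ, rfl⟩ := mem_closure_iff_nhds.1 (hτQ y) _ hev
    refine ⟨δ, h1, fun γ hγ => ?_⟩
    have h3 : decide (γ * δ ∈ A) = (τ y).1 γ := h2 γ hγ
    rw [mem_ofPred_eq, ← hτ1, ← h3, decide_eq_true_iff]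

/-- Amalgamation of types. -/
theorem exists_smul_mem_of_sameType (U : OpenSubgroup Γ) {y z : N}
    (h : SameType (U : Subgroup Γ) y z) {O W : Set N} (hO : O ∈ 𝓝 y) (hW : W ∈ 𝓝 z) :
    ∃ u ∈ U, ∃ w ∈ O, u • w ∈ W := by
  have := hN.continuousSMul
  obtain ⟨O', hO', hO'o, hy⟩ := mem_nhds_iff.1 hO
  let P : Set N := {w | ∃ u ∈ U, u • w ∈ O'}
  have hPo : IsOpen P := by
    have : P = ⋃ u ∈ U, {w | u • w ∈ O'} := by ext; simp [P]
    rw [this]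
    exact isOpen_biUnion fun u _ => hO'o.preimage (continuous_const_smul u)
  have hPi : ∀ u ∈ U, ∀ w, u • w ∈ P ↔ w ∈ P := by
    intro u hu w
    constructor
    · rintro ⟨t, ht, h⟩
      exact ⟨t * u, U.mul_mem ht hu, by rwa [mul_smul]⟩
    · rintro ⟨t, ht, h⟩
      exact ⟨t * u⁻¹, U.mul_mem ht (U.inv_mem hu), by simpa [smul_smul] using h⟩
  have hyP : y ∈ P := ⟨1, U.one_mem, by simpa using hy⟩
  -- Translates of `y` close to `y` lie in the open set `P`, which forces `y ∈ V`. Equality of types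
  -- gives `z ∈ V`, and then some translate of `y` in `W` lies in `P`.
  obtain ⟨V, hV, hcol⟩ := hN.exists_limit_coloring U y {γ | γ • y ∈ P} fun u hu γ => by
    rw [mem_ofPred_eq, mem_ofPred_eq, mul_smul]; exact hPi u hu _
  have hyV : y ∈ V := by
    obtain ⟨δ, h1, h2⟩ := hcol y P (hPo.mem_nhds hyP) {1} (finite_singleton 1)
    have := (h2 1 rfl).1 (by rw [one_mul]; exact h1)
    rwa [one_smul] at this
  have hzV : z ∈ V := (h V hV).1 hyV
  obtain ⟨δ, h1, h2⟩ := hcol z W hW {1} (finite_singleton 1)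
  have h3 : δ • y ∈ P := by
    have := (h2 1 rfl).2 (by rwa [one_smul])
    rwa [one_mul] at this
  obtain ⟨u, hu, h4⟩ := h3
  exact ⟨u⁻¹, U.inv_mem hu, u • δ • y, hO' h4, by simpa using h1⟩

end HasFiniteTypes

/-- A subflow of the closure of the base orbit of the ambit has finitely many types if it has only
countably many clopen sets. -/
theorem hasFiniteTypes_of_countable_clopens (Z : SubMulAction Γ (Ambit Γ))
    (hZc : IsClosed (Z : Set (Ambit Γ))) (hZn : Nonempty Z) (hZm : MulAction.IsMinimal Γ Z)
    (hZ : (Z : Set (Ambit Γ)) ⊆ closure (MulAction.orbit Γ Ambit.base))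
    (hc : {V : Set Z | IsClopen V}.Countable) : HasFiniteTypes Γ Z :=
  have hcomp : CompactSpace Z := isCompact_iff_compactSpace.1 hZc.isCompact
  { compact := hcomp
    hausdorff := inferInstanceAs (T2Space (Z : Set (Ambit Γ)))
    totallyDisconnected := inferInstanceAs (TotallyDisconnectedSpace (Z : Set (Ambit Γ)))
    nonempty := hZn
    continuousSMul := inferInstance
    minimal := hZm
    finite := finite_invClopens_of_countable_clopens Z hZ hc
    lift := fun Y _ _ _ _ _ hY => by
      obtain ⟨y⟩ := hY
      obtain ⟨f, hf, -⟩ := Ambit.exists_map y Z hZ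
      exact ⟨f, hf⟩ }

end Consequences

section PermutationGroups

/-! ### Groups of permutations of the natural numbers -/

theorem mem_nhds_perm_iff {g : Equiv.Perm ℕ} {W : Set (Equiv.Perm ℕ)} :
    W ∈ 𝓝 g ↔ ∃ F : Finset ℕ, {h : Equiv.Perm ℕ | ∀ k ∈ F, h k = g k} ⊆ W := by
  rw [nhds_induced, mem_comap]
  constructor
  · rintro ⟨T, hT, hTW⟩
    obtain ⟨T', hT'T, hT', hg⟩ := mem_nhds_iff.1 hT
    obtain ⟨F, t, ht, hF⟩ := isOpen_pi_iff.1 hT' _ hg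
    refine ⟨F, fun h hh => hTW (hT'T (hF fun k hk => ?_))⟩
    change h k ∈ t k
    rw [hh k hk]
    exact (ht k hk).2
  · rintro ⟨F, hF⟩
    refine ⟨{f | ∀ k ∈ F, f k = g k}, ?_, hF⟩
    exact (Filter.eventually_all_finset F).2 fun k _ =>
      (continuous_apply k).continuousAt.eventually_mem (mem_nhds_discrete.2 (mem_singleton _))

theorem eventually_perm_apply_eq (g : Equiv.Perm ℕ) (k : ℕ) : ∀ᶠ h in 𝓝 g, h k = g k :=
  mem_nhds_perm_iff.2 ⟨{k}, fun _ hh => hh k (Finset.mem_singleton_self k)⟩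

theorem continuousAt_perm_iff {X : Type*} [TopologicalSpace X] {f : X → Equiv.Perm ℕ} {x : X} :
    ContinuousAt f x ↔ ∀ k, ∀ᶠ y in 𝓝 x, f y k = f x k := by
  refine ⟨fun h k => h.eventually (eventually_perm_apply_eq _ k), fun h W hW => ?_⟩
  obtain ⟨F, hF⟩ := mem_nhds_perm_iff.1 hW
  have : ∀ᶠ y in 𝓝 x, ∀ k ∈ F, f y k = f x k := (Filter.eventually_all_finset F).2 fun k _ => h k
  exact mem_map.2 (mem_of_superset this fun y hy => hF hy)

instance : IsTopologicalGroup (Equiv.Perm ℕ) where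
  continuous_mul := by
    refine continuous_iff_continuousAt.2 ?_
    rintro ⟨g, h⟩
    refine continuousAt_perm_iff.2 fun k => ?_
    filter_upwards [continuous_fst.continuousAt.eventually (eventually_perm_apply_eq g (h k)),
      continuous_snd.continuousAt.eventually (eventually_perm_apply_eq h k)]
    rintro ⟨g', h'⟩ h1 h2
    change g' (h' k) = g (h k)
    rw [show h' k = h k from h2, show g' (h k) = g (h k) from h1]
  continuous_inv := by
    refine continuous_iff_continuousAt.2 fun g => continuousAt_perm_iff.2 fun k => ?_
    filter_upwards [eventually_perm_apply_eq g (g⁻¹ k)] with h hh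
    rw [Equiv.Perm.inv_eq_iff_eq, hh]
    simp

instance : T2Space (Equiv.Perm ℕ) :=
  T2Space.of_injective_continuous (f := fun g : Equiv.Perm ℕ => (g : ℕ → ℕ))
    DFunLike.coe_injective continuous_induced_dom

/-- The pointwise stabilizer of a finite set, as an open subgroup of the opposite group. -/
def pointStabilizer (G : Subgroup (Equiv.Perm ℕ)) (F : Finset ℕ) : OpenSubgroup Gᵐᵒᵖ where
  carrier := {γ | ∀ k ∈ F, γ.unop.1 k = k}
  one_mem' := fun k _ => rfl
  mul_mem' := by
    intro γ δ hγ hδ k hk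
    change δ.unop.1 (γ.unop.1 k) = k
    rw [hγ k hk, hδ k hk]
  inv_mem' := by
    intro γ hγ k hk
    change γ.unop.1⁻¹ k = k
    rw [Equiv.Perm.inv_eq_iff_eq, hγ k hk]
  isOpen' := by
    refine isOpen_iff_mem_nhds.2 fun γ hγ => ?_
    have hc : Continuous fun γ : Gᵐᵒᵖ => γ.unop.1 :=
      continuous_subtype_val.comp MulOpposite.continuous_unop
    have : ∀ᶠ δ in 𝓝 γ, ∀ k ∈ F, δ.unop.1 k = γ.unop.1 k := (Filter.eventually_all_finset F).2
      fun k _ => hc.continuousAt.eventually (eventually_perm_apply_eq _ k)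
    filter_upwards [this] with δ hδ k hk
    rw [hδ k hk, hγ k hk]

theorem exists_pointStabilizer_subset (G : Subgroup (Equiv.Perm ℕ)) {W : Set Gᵐᵒᵖ}
    (hW : W ∈ 𝓝 (1 : Gᵐᵒᵖ)) : ∃ F : Finset ℕ, (pointStabilizer G F : Set Gᵐᵒᵖ) ⊆ W := by
  have h1 : W ∈ comap (fun γ : Gᵐᵒᵖ => γ.unop.1) (𝓝 1) := by
    have : IsInducing fun γ : Gᵐᵒᵖ => γ.unop.1 :=
      IsInducing.subtypeVal.comp MulOpposite.opHomeomorph.symm.isInducing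
    have h2 := this.nhds_eq_comap 1
    rw [h2] at hW
    exact hW
  obtain ⟨T, hT, hTW⟩ := h1
  obtain ⟨F, hF⟩ := mem_nhds_perm_iff.1 hT
  exact ⟨F, fun γ hγ => hTW (hF fun k hk => hγ k hk)⟩

instance (G : Subgroup (Equiv.Perm ℕ)) : NonarchimedeanGroup Gᵐᵒᵖ where
  is_nonarchimedean W hW := by
    obtain ⟨F, hF⟩ := exists_pointStabilizer_subset G hW
    exact ⟨_, hF⟩

theorem exists_pointStabilizer_le (G : Subgroup (Equiv.Perm ℕ)) (U : OpenSubgroup Gᵐᵒᵖ) :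
    ∃ F : Finset ℕ, (pointStabilizer G F : Subgroup Gᵐᵒᵖ) ≤ U :=
  exists_pointStabilizer_subset G (U.isOpen.mem_nhds U.one_mem)

end PermutationGroups

section Relational

/-! ### Relational structures -/

open FirstOrder FirstOrder.Language

/-- An injection which preserves and reflects all relations is an embedding. -/
def embeddingOfRel {L' : FirstOrder.Language.{a, b}} [L'.IsRelational] {A : Type*} {B : Type*}
    [L'.Structure A] [L'.Structure B] (f : A → B) (hf : Function.Injective f)
    (h : ∀ (n : ℕ) (R : L'.Relations n) (t : Fin n → A),
      Structure.RelMap R (f ∘ t) ↔ Structure.RelMap R t) : A ↪[L'] B where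
  toFun := f
  inj' := hf
  map_fun' := fun {_} φ _ => isEmptyElim φ
  map_rel' := fun {n} R t => h n R t

variable {L : FirstOrder.Language.{a, b}} [L.IsRelational] [L.Structure ℕ]

theorem autGroup_relMap (g : autGroup L) {n : ℕ} (R : L.Relations n) (t : Fin n → ℕ) :
    Structure.RelMap R (g.1 ∘ t) ↔ Structure.RelMap R t := by
  obtain ⟨_, φ, rfl⟩ := g
  exact φ.map_rel' R t

/-- Ultrahomogeneity in the form used below: the partial map carrying `e` to `e'` lives on the
finite substructure `range e`. -/
theorem exists_autGroup_extension (hL : L.IsUltrahomogeneous ℕ) {A : Type} [Finite A] (e e' : A → ℕ)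
    (he : Function.Injective e) (he' : Function.Injective e')
    (h : ∀ (n : ℕ) (R : L.Relations n) (t : Fin n → A),
      Structure.RelMap R (e ∘ t) ↔ Structure.RelMap R (e' ∘ t)) :
    ∃ g : autGroup L, ∀ x, g.1 (e x) = e' x := by
  let T : L.Substructure ℕ := Substructure.closure L (range e)
  have hT : ∀ k : T, ∃ x, e x = k := fun k =>
    (Substructure.mem_closure_iff_of_isRelational L (range e) k.1).1 k.2
  choose d hd using hT
  obtain ⟨φ, hφ⟩ := hL T (Substructure.fg_closure (finite_range e))
    (embeddingOfRel (fun k : T => e' (d k))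
      (fun k l hkl => Subtype.ext (by rw [← hd k, ← hd l, he' hkl]))
      (fun n R t => by
        have h1 := h n R (fun i => d (t i))
        have h2 : (e ∘ fun i => d (t i)) = fun i => (t i : ℕ) := funext fun i => hd (t i)
        rw [h2] at h1
        exact h1.symm))
  refine ⟨⟨φ.toEquiv, φ, rfl⟩, fun x => ?_⟩
  have hx : e x ∈ T := Substructure.subset_closure ⟨x, rfl⟩
  have h1 := congrArg (fun f : T ↪[L] ℕ => f ⟨e x, hx⟩) hφ
  have h2 : d ⟨e x, hx⟩ = x := he (hd ⟨e x, hx⟩)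
  have h3 : e' (d ⟨e x, hx⟩) = φ (e x) := h1
  rw [h2] at h3
  exact h3.symm

end Relational

section TypeStructures

/-! ### The structures of types of the points of a flow -/

open FirstOrder FirstOrder.Language MulOpposite

/-- The range of a tuple. -/
def tupleRange {n : ℕ} (t : Fin n → ℕ) : Finset ℕ := Finset.univ.image t

theorem mem_tupleRange {n : ℕ} (t : Fin n → ℕ) (i : Fin n) : t i ∈ tupleRange t :=
  Finset.mem_image_of_mem t (Finset.mem_univ i)

theorem mem_tupleRange_iff {n : ℕ} {t : Fin n → ℕ} {k : ℕ} : k ∈ tupleRange t ↔ ∃ i, t i = k := by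
  simp [tupleRange]

theorem exists_tupleRange_eq (F : Finset ℕ) : ∃ (n : ℕ) (t : Fin n → ℕ), tupleRange t = F := by
  refine ⟨F.card, fun i => F.equivFin.symm i, ?_⟩
  ext k
  rw [mem_tupleRange_iff]
  constructor
  · rintro ⟨i, rfl⟩
    exact (F.equivFin.symm i).2
  · intro hk
    exact ⟨F.equivFin ⟨k, hk⟩, by simp⟩

/-- The range of a function on a finite type. -/
noncomputable def rangeFinset {A : Type} [Finite A] (f : A → ℕ) : Finset ℕ :=
  (finite_range f).toFinset

theorem mem_rangeFinset {A : Type} [Finite A] (f : A → ℕ) (k : A) : f k ∈ rangeFinset f :=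
  (Finite.mem_toFinset _).2 ⟨k, rfl⟩

theorem exists_of_mem_rangeFinset {A : Type} [Finite A] (f : A → ℕ) :
    ∀ k ∈ rangeFinset f, ∃ i, f i = k :=
  fun _ hk => (Finite.mem_toFinset (finite_range f)).1 hk

/-- The relational language whose relation symbols are the pairs of a tuple and a clopen set that
is invariant under its stabilizer. -/
def typeLanguage (G : Subgroup (Equiv.Perm ℕ)) (N : Type) [TopologicalSpace N]
    [MulAction Gᵐᵒᵖ N] : FirstOrder.Language.{0, 0} where
  Functions _ := Empty
  Relations n := Σ t : Fin n → ℕ, invClopens N (pointStabilizer G (tupleRange t) : Subgroup Gᵐᵒᵖ)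

instance (G : Subgroup (Equiv.Perm ℕ)) (N : Type) [TopologicalSpace N] [MulAction Gᵐᵒᵖ N] :
    (typeLanguage G N).IsRelational := fun _ => inferInstanceAs (IsEmpty Empty)

variable {G : Subgroup (Equiv.Perm ℕ)} {N : Type} [TopologicalSpace N] [MulAction Gᵐᵒᵖ N]

/-- The structure of the types of a point. -/
@[reducible]
def typeStructure (G : Subgroup (Equiv.Perm ℕ)) {N : Type} [TopologicalSpace N]
    [MulAction Gᵐᵒᵖ N] (x : N) : (typeLanguage G N).Structure ℕ where
  funMap := fun f => isEmptyElim f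
  RelMap := fun r t => ∃ g : G, g.1 ∘ r.1 = t ∧ op g • x ∈ r.2.1

/-- The group element carrying `r.1` to a given tuple is unique up to the stabilizer of `r.1`, under
which the clopen set `r.2` is invariant. So the existential can be tested on any one element. -/
theorem typeStructure_relMap (x : N) (g : G) {n : ℕ} (r : (typeLanguage G N).Relations n) :
    (typeStructure G x).RelMap r (g.1 ∘ r.1) ↔ op g • x ∈ r.2.1 := by
  refine ⟨?_, fun h => ⟨g, rfl, h⟩⟩
  rintro ⟨g', hg', h⟩
  have hu : op (g⁻¹ * g') ∈ (pointStabilizer G (tupleRange r.1) : Subgroup Gᵐᵒᵖ) := by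
    intro k hk
    obtain ⟨i, rfl⟩ := mem_tupleRange_iff.1 hk
    have h1 : g'.1 (r.1 i) = g.1 (r.1 i) := congrFun hg' i
    change g.1⁻¹ (g'.1 (r.1 i)) = r.1 i
    rw [h1]
    simp
  rw [← r.2.2.2 _ hu (op g • x), smul_smul, ← op_mul]
  simpa using h

theorem typeStructure_smul (x : N) (h : G) :
    typeStructure G (op h • x) = ExpansionSpace.translate (typeStructure G x) h.1 := by
  apply FirstOrder.Language.Structure.ext
  · funext n f
    exact isEmptyElim f
  · funext n r t
    refine propext ⟨?_, ?_⟩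
    · rintro ⟨g, rfl, hg⟩
      exact ⟨h * g, rfl, by rwa [op_mul, mul_smul]⟩
    · rintro ⟨g, hg, hx⟩
      refine ⟨h⁻¹ * g, ?_, by rwa [smul_smul, ← op_mul, mul_inv_cancel_left]⟩
      funext i
      have := congrFun hg i
      change h.1⁻¹ (g.1 (r.1 i)) = t i
      rw [show g.1 (r.1 i) = h.1 (t i) from this]
      simp

/-- The type of a point over a finite set is the restriction of its structure to the set. -/
theorem sameType_iff_relMap [ContinuousConstSMul Gᵐᵒᵖ N] (F : Finset ℕ) (x y : N) :
    SameType (pointStabilizer G F : Subgroup Gᵐᵒᵖ) x y ↔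
      ∀ (n : ℕ) (r : (typeLanguage G N).Relations n) (t : Fin n → ℕ), (∀ i, t i ∈ F) →
        ((typeStructure G x).RelMap r t ↔ (typeStructure G y).RelMap r t) := by
  constructor
  · intro h n r t ht
    by_cases hg : ∃ g : G, g.1 ∘ r.1 = t
    · obtain ⟨g, rfl⟩ := hg
      rw [typeStructure_relMap, typeStructure_relMap]
      refine h.smul (op g) (W := pointStabilizer G F) ?_ _ r.2.2
      intro w hw k hk
      obtain ⟨i, rfl⟩ := mem_tupleRange_iff.1 hk
      change g.1⁻¹ (w.unop.1 (g.1 (r.1 i))) = r.1 i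
      rw [show w.unop.1 (g.1 (r.1 i)) = g.1 (r.1 i) from hw _ (ht i)]
      simp
    -- A tuple outside the orbit of `r.1` satisfies the relation for no point.
    · refine iff_of_false ?_ ?_ <;>
      · rintro ⟨g, hgt, -⟩
        exact hg ⟨g, hgt⟩
  · intro h V hV
    obtain ⟨n, t, rfl⟩ := exists_tupleRange_eq F
    -- For a tuple `t` enumerating `F`, the symbol `⟨t, V⟩` evaluated at `t` itself asks whether the
    -- point is in `V`.
    have h1 := h n ⟨t, V, hV⟩ t (mem_tupleRange t)
    have h2 := typeStructure_relMap x 1 ⟨t, V, hV⟩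
    have h3 := typeStructure_relMap y 1 ⟨t, V, hV⟩
    rw [op_one, one_smul] at h2 h3
    exact h2.symm.trans (h1.trans h3)

theorem countable_typeLanguage (hN : HasFiniteTypes Gᵐᵒᵖ N) :
    Countable (typeLanguage G N).Symbols := by
  have h1 : ∀ n, Countable ((typeLanguage G N).Relations n) := by
    intro n
    have : ∀ t : Fin n → ℕ,
        Countable (invClopens N (pointStabilizer G (tupleRange t) : Subgroup Gᵐᵒᵖ)) :=
      fun t => (hN.finite _).countable.to_subtype
    exact inferInstanceAs (Countable (Σ t : Fin n → ℕ,
      invClopens N (pointStabilizer G (tupleRange t) : Subgroup Gᵐᵒᵖ)))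
  have h2 : ∀ n, Countable ((typeLanguage G N).Functions n) := fun n =>
    inferInstanceAs (Countable Empty)
  exact inferInstanceAs (Countable ((Σ n, (typeLanguage G N).Functions n) ⊕
    (Σ n, (typeLanguage G N).Relations n)))

end TypeStructures

/-! ### Embeddings into expansions by types -/

section Expansions

open FirstOrder FirstOrder.Language MulOpposite

variable {L : FirstOrder.Language.{a, b}} [L.IsRelational] [L.Structure ℕ]
  {N : Type} [TopologicalSpace N] [MulAction (autGroup L)ᵐᵒᵖ N]

/-- The expansion of the given structure by the types of a point. -/
abbrev typeExpansion (L : FirstOrder.Language.{a, b}) [L.IsRelational] [L.Structure ℕ]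
    {N : Type} [TopologicalSpace N] [MulAction (autGroup L)ᵐᵒᵖ N] (x : N) :
    Bundled.{0} (L.sum (typeLanguage (autGroup L) N)).Structure :=
  expandNat L (typeStructure (autGroup L) x)

theorem embedding_relMap_inl {A : Type} [(L.sum (typeLanguage (autGroup L) N)).Structure A] {x : N}
    (e : A ↪[L.sum (typeLanguage (autGroup L) N)] typeExpansion L x) {n : ℕ} (R : L.Relations n)
    (t : Fin n → A) : Structure.RelMap (M := ℕ) R (e ∘ t) ↔
      Structure.RelMap (L := L.sum (typeLanguage (autGroup L) N)) (Sum.inl R) t :=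
  e.map_rel' (Sum.inl R) t

theorem embedding_relMap_inr {A : Type} [(L.sum (typeLanguage (autGroup L) N)).Structure A] {x : N}
    (e : A ↪[L.sum (typeLanguage (autGroup L) N)] typeExpansion L x) {n : ℕ}
    (r : (typeLanguage (autGroup L) N).Relations n)
    (t : Fin n → A) : (typeStructure (autGroup L) x).RelMap r (e ∘ t) ↔
      Structure.RelMap (L := L.sum (typeLanguage (autGroup L) N)) (Sum.inr r) t :=
  e.map_rel' (Sum.inr r) t

/-- An embedding into one expansion composes with an automorphism to an embedding into another
expansion, if the types agree. -/
theorem exists_embedding_of_sameType [ContinuousConstSMul (autGroup L)ᵐᵒᵖ N] {A : Type}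
    [(L.sum (typeLanguage (autGroup L) N)).Structure A] {x y : N}
    (e : A ↪[L.sum (typeLanguage (autGroup L) N)] typeExpansion L x) (g : autGroup L) (F : Finset ℕ)
    (hF : ∀ k, e k ∈ F)
    (h : SameType (pointStabilizer (autGroup L) F : Subgroup (autGroup L)ᵐᵒᵖ) x (op g • y)) :
    ∃ e' : A ↪[L.sum (typeLanguage (autGroup L) N)] typeExpansion L y, ∀ k, e' k = g.1 (e k) := by
  refine ⟨embeddingOfRel (fun k => g.1 (e k)) (fun k l hkl => e.injective (g.1.injective hkl)) ?_,
    fun k => rfl⟩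
  rintro n (R | r) t
  · refine Iff.trans ?_ (embedding_relMap_inl e R t)
    exact autGroup_relMap g R (e ∘ t)
  · refine Iff.trans ?_ (embedding_relMap_inr e r t)
    rw [(sameType_iff_relMap F x _).1 h n r (e ∘ t) (fun i => hF (t i)), typeStructure_smul]
    exact Iff.rfl

/-- Any two embeddings of a finite structure into expansions differ by an automorphism that
preserves types. -/
theorem exists_sameType_of_embedding [ContinuousConstSMul (autGroup L)ᵐᵒᵖ N]
    (hL : L.IsUltrahomogeneous ℕ) {A : Type} [Finite A]
    [(L.sum (typeLanguage (autGroup L) N)).Structure A] {x y : N}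
    (e : A ↪[L.sum (typeLanguage (autGroup L) N)] typeExpansion L x)
    (e' : A ↪[L.sum (typeLanguage (autGroup L) N)] typeExpansion L y) (F : Finset ℕ)
    (hF : ∀ k ∈ F, ∃ i, e i = k) :
    ∃ g : autGroup L, (∀ k, e' k = g.1 (e k)) ∧
      SameType (pointStabilizer (autGroup L) F : Subgroup (autGroup L)ᵐᵒᵖ) x (op g • y) := by
  obtain ⟨g, hg⟩ := exists_autGroup_extension hL e e' e.injective e'.injective fun n R t =>
    (embedding_relMap_inl e R t).trans (embedding_relMap_inl e' R t).symm
  refine ⟨g, fun k => (hg k).symm, (sameType_iff_relMap F _ _).2 fun n r t ht => ?_⟩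
  choose d hd using fun i => hF (t i) (ht i)
  have h1 : t = e ∘ d := funext fun i => (hd i).symm
  have h2 : (fun i => g.1 (t i)) = e' ∘ d := funext fun i => by rw [h1]; exact hg (d i)
  rw [typeStructure_smul]
  change _ ↔ (typeStructure (autGroup L) y).RelMap r (fun i => g.1 (t i))
  rw [h2, h1]
  exact (embedding_relMap_inr e r d).trans (embedding_relMap_inr e' r d).symm

/-- By minimality a translate of `y` has the type of `x` over the range of a given finite embedding.
-/
theorem age_typeExpansion_subset (hN : HasFiniteTypes (autGroup L)ᵐᵒᵖ N) (x y : N) :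
    (L.sum (typeLanguage (autGroup L) N)).age (typeExpansion L x) ⊆
      (L.sum (typeLanguage (autGroup L) N)).age (typeExpansion L y) := by
  have := hN.continuousSMul
  rintro A ⟨hA, ⟨e⟩⟩
  have : Finite A := Structure.fg_iff_finite.1 hA
  obtain ⟨γ, hγ⟩ := hN.exists_smul_sameType (pointStabilizer _ (rangeFinset e)) x y
  obtain ⟨e', -⟩ := exists_embedding_of_sameType e γ.unop (rangeFinset e) (mem_rangeFinset e) hγ
  exact ⟨hA, ⟨e'⟩⟩

theorem age_typeExpansion_eq (hN : HasFiniteTypes (autGroup L)ᵐᵒᵖ N) (x y : N) :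
    (L.sum (typeLanguage (autGroup L) N)).age (typeExpansion L x) =
      (L.sum (typeLanguage (autGroup L) N)).age (typeExpansion L y) :=
  (age_typeExpansion_subset hN x y).antisymm (age_typeExpansion_subset hN y x)

/-- The pullback of a relational structure along a map. -/
@[reducible]
def pullback {S : FirstOrder.Language.{0, 0}} [S.IsRelational] {A : Type} (s : S.Structure ℕ)
    (j : A → ℕ) : S.Structure A where
  funMap := fun f => isEmptyElim f
  RelMap := fun r t => s.RelMap r (j ∘ t)

/-- The expansions of a finite substructure are the restrictions of the structures of types. -/
theorem mem_expansions_iff (hN : HasFiniteTypes (autGroup L)ᵐᵒᵖ N) (hL : L.IsUltrahomogeneous ℕ)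
    (x₀ : N) (A : Bundled.{0} L.Structure) [Finite A] (j : A ↪[L] ℕ)
    (s : (typeLanguage (autGroup L) N).Structure A) :
    s ∈ expansions ((L.sum (typeLanguage (autGroup L) N)).age (typeExpansion L x₀)) A ↔
      ∃ y : N, s = pullback (typeStructure (autGroup L) y) j := by
  have := hN.continuousSMul
  constructor
  · rintro ⟨-, ⟨e⟩⟩
    obtain ⟨g, hg⟩ := exists_autGroup_extension hL j e j.injective e.injective fun n R t => by
      refine (j.map_rel' R t).trans ?_
      exact (embedding_relMap_inl e R t).symm
    -- Since `g` carries `j` to `e`, restricting `op g • x₀` along `j` is restricting `x₀` along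
    -- `e`.
    refine ⟨op g • x₀, ?_⟩
    apply FirstOrder.Language.Structure.ext
    · funext n f
      exact isEmptyElim f
    · funext n r t
      have h1 := embedding_relMap_inr e r t
      have h2 : (e ∘ t : Fin n → ℕ) = fun i => g.1 (j (t i)) := funext fun i => (hg (t i)).symm
      rw [h2] at h1
      rw [typeStructure_smul]
      exact propext h1.symm
  · rintro ⟨y, rfl⟩
    change expand A _ ∈ (L.sum (typeLanguage (autGroup L) N)).age (typeExpansion L x₀)
    rw [age_typeExpansion_eq hN x₀ y]
    have : Finite (expand A (pullback (typeStructure (autGroup L) y) j)) :=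
      inferInstanceAs (Finite A)
    refine ⟨Structure.fg_iff_finite.2 this, ⟨embeddingOfRel (fun k : A => j k) j.injective ?_⟩⟩
    rintro n (R | r) t
    · exact j.map_rel' R t
    · exact Iff.rfl

end Expansions

/-! ### Compactness for the Ramsey property -/

section FiniteRamsey

open FirstOrder FirstOrder.Language

/-- The Ramsey property for the embeddings into a structure passes to a finite substructure. -/
theorem exists_finite_ramsey {L' : FirstOrder.Language.{a, b}} [L'.IsRelational] {M A B : Type}
    [L'.Structure M] [L'.Structure A] [L'.Structure B] [Finite A] [Finite B] (j : B ↪[L'] M)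
    (h : ∀ γ : (A ↪[L'] M) → Fin 2, ∃ f : B ↪[L'] M, ∀ e e' : A ↪[L'] B,
      γ (f.comp e) = γ (f.comp e')) :
    ∃ T : L'.Substructure M, T.FG ∧ (∀ k, j k ∈ T) ∧
      ∀ γ : (A ↪[L'] T) → Fin 2, ∃ f : B ↪[L'] T, ∀ e e' : A ↪[L'] B,
        γ (f.comp e) = γ (f.comp e') := by
  classical
  by_contra! hcon
  have hbad : ∀ D : Finset M, ∃ γ : (A ↪[L'] Substructure.closure L' (D : Set M)) → Fin 2,
      (∀ k, j k ∈ Substructure.closure L' (D : Set M)) →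
      ∀ f : B ↪[L'] Substructure.closure L' (D : Set M), ∃ e e' : A ↪[L'] B,
        γ (f.comp e) ≠ γ (f.comp e') := by
    intro D
    by_cases hD : ∀ k, j k ∈ Substructure.closure L' (D : Set M)
    · obtain ⟨γ, hγ⟩ := hcon _ (Substructure.fg_closure D.finite_toSet) hD
      exact ⟨γ, fun _ => hγ⟩
    · exact ⟨fun _ => 0, fun h => absurd h hD⟩
  -- If every finite part has a bad colouring, their limit along an ultrafilter of finite sets
  -- colours all copies in `M`. A copy of `B` good for the limit is good for some finite part, since
  -- only finitely many copies of `A` are involved.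
  choose γ hγ using hbad
  let γ' : Finset M → (A ↪[L'] M) → Fin 2 := fun D e =>
    if hD : ∀ k, e k ∈ Substructure.closure L' (D : Set M) then
      γ D (Embedding.codRestrict _ e hD) else 0
  let 𝔲 : Ultrafilter (Finset M) := Ultrafilter.of atTop
  have h𝔲 : (𝔲 : Filter (Finset M)) ≤ atTop := Ultrafilter.of_le _
  let γlim : (A ↪[L'] M) → Fin 2 := fun e => if ∀ᶠ D in 𝔲, γ' D e = 1 then 1 else 0
  have hlim : ∀ e, ∀ᶠ D in 𝔲, γ' D e = γlim e := by
    intro e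
    by_cases he : ∀ᶠ D in 𝔲, γ' D e = 1
    · simpa only [γlim, if_pos he] using he
    · simp only [γlim, if_neg he]
      filter_upwards [Ultrafilter.eventually_not.2 he] with D hD
      omega
  obtain ⟨f, hf⟩ := h γlim
  have hall : ∀ j : B ↪[L'] M, ∀ᶠ D : Finset M in 𝔲, ∀ k, j k ∈ Substructure.closure L' (D : Set M) := by
    intro j
    refine h𝔲 ?_
    filter_upwards [eventually_ge_atTop (finite_range j).toFinset] with D hD k
    exact Substructure.subset_closure (hD ((Finite.mem_toFinset _).2 ⟨k, rfl⟩))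
  have hfin : Finite (A ↪[L'] B) := DFunLike.finite _
  obtain ⟨D, hD1, hD2, hD3⟩ := ((hall j).and ((hall f).and
    (Filter.eventually_all.2 fun e : A ↪[L'] B => hlim (f.comp e)))).exists
  obtain ⟨e, e', hne⟩ := hγ D hD1 (Embedding.codRestrict _ f hD2)
  have key : ∀ e : A ↪[L'] B, γ D ((Embedding.codRestrict _ f hD2).comp e) = γlim (f.comp e) := by
    intro e
    rw [← hD3 e]
    have hk : ∀ k, f.comp e k ∈ Substructure.closure L' (D : Set M) := fun k => hD2 (e k)
    simp only [γ']
    rw [dif_pos hk]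
    rfl
  exact hne (by rw [key, key, hf e e'])

end FiniteRamsey

/-! ### The class of type expansions is excellent -/

section Excellence

open FirstOrder FirstOrder.Language MulOpposite

theorem exists_finite_representatives {Γ : Type*} [Group Γ] {N : Type*} [TopologicalSpace N]
    [MulAction Γ N] {U : Subgroup Γ} (h : (invClopens N U).Finite) :
    ∃ T : Set N, T.Finite ∧ ∀ y, ∃ t ∈ T, SameType U y t := by
  let f : N → Set (Set N) := fun y => {V ∈ invClopens N U | y ∈ V}
  have hf : (range f).Finite :=
    h.finite_subsets.subset (range_subset_iff.2 fun y => sep_subset _ _)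
  choose d hd using fun t : range f => t.2
  have := hf.to_subtype
  refine ⟨range d, finite_range d, fun y => ⟨d ⟨f y, y, rfl⟩, ⟨_, rfl⟩, fun V hV => ?_⟩⟩
  have h1 : V ∈ f (d ⟨f y, y, rfl⟩) ↔ V ∈ f y := by rw [hd]
  exact ⟨fun hy => (h1.2 ⟨hV, hy⟩).2, fun hy => (h1.1 ⟨hV, hy⟩).2⟩

variable {L : FirstOrder.Language.{a, b}} [L.IsRelational] [L.Structure ℕ]
  {N : Type} [TopologicalSpace N] [MulAction (autGroup L)ᵐᵒᵖ N]

/-- The class of the finite structures that embed in the expansion by the types of a point. -/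
abbrev typeAge (L : FirstOrder.Language.{a, b}) [L.IsRelational] [L.Structure ℕ]
    {N : Type} [TopologicalSpace N] [MulAction (autGroup L)ᵐᵒᵖ N] (x : N) :
    Set (Bundled.{0} (L.sum (typeLanguage (autGroup L) N)).Structure) :=
  (L.sum (typeLanguage (autGroup L) N)).age (typeExpansion L x)

variable (hN : HasFiniteTypes (autGroup L)ᵐᵒᵖ N) (hL : L.IsUltrahomogeneous ℕ) (x : N)
include hN hL

theorem isExpansionClass_typeAge : IsExpansionClass (typeAge L x) (L.age ℕ) := by
  refine ⟨fun A B hAB hA => (age.is_equiv_invariant _ _ A B hAB).1 hA, fun A => ⟨?_, ?_⟩⟩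
  · rintro ⟨hA, ⟨j⟩⟩
    have : Finite A := Structure.fg_iff_finite.1 hA
    exact ⟨_, (mem_expansions_iff hN hL x A j _).2 ⟨x, rfl⟩⟩
  · rintro ⟨s, hA, ⟨e⟩⟩
    have : Finite A := Structure.fg_iff_finite.1 hA
    exact ⟨Structure.fg_iff_finite.2 this, ⟨embeddingOfRel (fun k : A => (e k : ℕ)) e.injective
      fun n R t => embedding_relMap_inl e R t⟩⟩

/-- An expansion of `A` is determined by a type over the image of `A` in `ℕ`, and there are finitely
many of these. -/
theorem isPrecompact_typeAge : IsPrecompact (typeAge L x) (L.age ℕ) := by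
  have := hN.continuousSMul
  rintro A ⟨hA, ⟨j⟩⟩
  have : Finite A := Structure.fg_iff_finite.1 hA
  obtain ⟨T, hT, hrep⟩ := exists_finite_representatives
    (hN.finite (pointStabilizer (autGroup L) (rangeFinset j)))
  refine (hT.image fun y => pullback (typeStructure (autGroup L) y) j).subset ?_
  intro s hs
  obtain ⟨y, rfl⟩ := (mem_expansions_iff hN hL x A j s).1 hs
  obtain ⟨t, ht, hyt⟩ := hrep y
  refine ⟨t, ht, ?_⟩
  apply FirstOrder.Language.Structure.ext
  · funext n f
    exact isEmptyElim f
  · funext n r k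
    exact propext ((sameType_iff_relMap _ y t).1 hyt n r (j ∘ k)
      fun i => mem_rangeFinset j (k i)).symm

/-- The expansion of `A` is the restriction of a point `y` along `j.comp f`; restricting the same
`y` along `j` expands `B`. -/
theorem isReasonable_typeAge : IsReasonable (typeAge L x) (L.age ℕ) := by
  rintro A ⟨hA, -⟩ B ⟨hB, ⟨j⟩⟩ f s hs
  have : Finite A := Structure.fg_iff_finite.1 hA
  have : Finite B := Structure.fg_iff_finite.1 hB
  obtain ⟨y, rfl⟩ := (mem_expansions_iff hN hL x A (j.comp f) s).1 hs
  refine ⟨pullback (typeStructure (autGroup L) y) j,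
    (mem_expansions_iff hN hL x B j _).2 ⟨y, rfl⟩,
    embeddingOfRel (fun k : A => f k) f.injective ?_, fun k => rfl⟩
  rintro n (R | r) t
  · exact f.map_rel' R t
  · exact Iff.rfl

/-- By minimality and compactness finitely many translates of the set of points with the type of `x`
over the copy of `A` cover `N`. The matching translates of the copy together generate `B`. -/
theorem hasExpansionProperty_typeAge : HasExpansionProperty (typeAge L x) (L.age ℕ) := by
  classical
  have := hN.continuousSMul
  have := hN.compact
  have := hN.minimal
  rintro A ⟨hA, ⟨e⟩⟩
  have : Finite A := Structure.fg_iff_finite.1 hA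
  obtain ⟨I, hI⟩ := isCompact_univ.exists_finite_cover_smul (autGroup L)ᵐᵒᵖ
    (isClopen_setOf_sameType
      (hN.finite (pointStabilizer (autGroup L) (rangeFinset (A := A) e))) x).1.2 ⟨x, SameType.refl _ x⟩
  -- A point `y` in the translate by `γ` is such that `γ⁻¹ • y` has the type of `x`, so the copy of
  -- `A` in the expansion at `y` is moved by `γ⁻¹`.
  let F : Finset ℕ := I.biUnion fun γ => (rangeFinset (A := A) e).image γ⁻¹.unop.1
  let B : L.Substructure ℕ := Substructure.closure L F
  have hB : Structure.FG L B := (Substructure.fg_iff_structure_fg B).1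
    (Substructure.fg_closure F.finite_toSet)
  have : Finite B := Structure.fg_iff_finite.1 hB
  refine ⟨⟨B, inferInstance⟩, ⟨hB, ⟨B.subtype⟩⟩, fun t ht => ?_⟩
  obtain ⟨y, rfl⟩ := (mem_expansions_iff hN hL x ⟨B, inferInstance⟩ B.subtype t).1 ht
  obtain ⟨γ, hγ, z, hz, hzy⟩ := mem_iUnion₂.1 (hI (mem_univ y))
  have hzy' : z = γ⁻¹ • y := by rw [← hzy]; simp
  rw [hzy'] at hz
  obtain ⟨e', he'⟩ := exists_embedding_of_sameType e γ⁻¹.unop (rangeFinset (A := A) e)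
    (mem_rangeFinset (A := A) e) hz
  have hmem : ∀ k, (e' k : ℕ) ∈ B := fun k => by
    refine Substructure.subset_closure (Finset.mem_biUnion.2 ⟨γ, hγ, ?_⟩)
    rw [he' k]
    exact Finset.mem_image_of_mem _ (mem_rangeFinset (A := A) e k)
  refine ⟨embeddingOfRel (fun k : A => (⟨e' k, hmem k⟩ : B))
    (fun k l hkl => e'.injective (Subtype.ext_iff.1 hkl)) ?_⟩
  rintro n (R | r) k
  · exact embedding_relMap_inl e' R k
  · exact embedding_relMap_inr e' r k

/-- A colouring of copies of `A` becomes a colouring of group elements through `δ ↦ δ ∘ eA`. All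
copies of `A` in `B` come from elements that preserve the type of `x`, so a limit colouring gives
them the same colour. -/
theorem hasRamseyProperty_typeAge : HasRamseyProperty (typeAge L x) := by
  have := hN.continuousSMul
  rintro A ⟨hA, -⟩ B ⟨hB, ⟨eB⟩⟩ ⟨g₀⟩
  have : Finite A := Structure.fg_iff_finite.1 hA
  have : Finite B := Structure.fg_iff_finite.1 hB
  let eA := eB.comp g₀
  have hfin : Finite (A ↪[L.sum (typeLanguage (autGroup L) N)] B) := DFunLike.finite _
  have hlim : ∀ γ : (A ↪[L.sum (typeLanguage (autGroup L) N)] typeExpansion L x) → Fin 2,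
      ∃ f : B ↪[L.sum (typeLanguage (autGroup L) N)] typeExpansion L x,
        ∀ e e' : A ↪[L.sum (typeLanguage (autGroup L) N)] B, γ (f.comp e) = γ (f.comp e') := by
    intro γ
    -- Elements that do not carry `eA` to an embedding of the expansions are left out, which amounts
    -- to giving them colour `0`.
    let 𝒜 : Set (autGroup L)ᵐᵒᵖ :=
      {δ | ∃ e : A ↪[L.sum (typeLanguage (autGroup L) N)] typeExpansion L x,
        (∀ k, e k = δ.unop.1 (eA k)) ∧ γ e = 1}
    obtain ⟨V, hV, hcol⟩ := hN.exists_limit_coloring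
      (pointStabilizer (autGroup L) (rangeFinset (A := A) eA)) x 𝒜 (by
        intro u hu δ
        have h1 : ∀ k, (u * δ).unop.1 (eA k) = δ.unop.1 (eA k) := fun k =>
          congrArg δ.unop.1 (hu _ (mem_rangeFinset (A := A) eA k))
        simp only [𝒜, mem_ofPred_eq, h1])
    choose g hg hgx using fun e : A ↪[L.sum (typeLanguage (autGroup L) N)] B =>
      exists_sameType_of_embedding hL eA (eB.comp e) (rangeFinset (A := A) eA)
        (exists_of_mem_rangeFinset (A := A) eA)
    obtain ⟨δ, hδ, hδE⟩ := hcol x _ (hN.setOf_sameType_mem_nhds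
      (pointStabilizer (autGroup L) (rangeFinset (A := B) eB)) x)
      (range fun e => op (g e)) (finite_range _)
    obtain ⟨f, hf⟩ := exists_embedding_of_sameType eB δ.unop (rangeFinset (A := B) eB)
      (mem_rangeFinset (A := B) eB) hδ
    have key : ∀ e : A ↪[L.sum (typeLanguage (autGroup L) N)] B,
        γ (f.comp e) = 1 ↔ x ∈ V := by
      intro e
      have hfe : ∀ k, f.comp e k = (op (g e) * δ).unop.1 (eA k) := fun k =>
        (hf (e k)).trans (congrArg δ.unop.1 (hg e k))
      rw [hgx e V hV, ← hδE _ ⟨e, rfl⟩]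
      refine ⟨fun h => ⟨f.comp e, hfe, h⟩, ?_⟩
      rintro ⟨e', he', h⟩
      have : e' = f.comp e := Embedding.ext fun k => (he' k).trans (hfe k).symm
      rwa [← this]
    refine ⟨f, fun e e' => ?_⟩
    have := (key e).trans (key e').symm
    omega
  obtain ⟨T, hT, hTB, hTR⟩ := exists_finite_ramsey eB hlim
  refine ⟨⟨T, inferInstance⟩, age.fg_substructure hT, ⟨Embedding.codRestrict T eA fun k => hTB _⟩, hTR⟩

end Excellence

section Limit

/-! ### The generic structure of types -/

open FirstOrder FirstOrder.Language MulOpposite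

section Extension

variable {G : Subgroup (Equiv.Perm ℕ)} {N : Type} [TopologicalSpace N] [MulAction Gᵐᵒᵖ N]

/-- A partial automorphism extends to one more point, for a finite part of the group. -/
def ExtendsType (F : Finset ℕ) (k : ℕ) (g : G) (x : N) : Prop :=
  SameType (pointStabilizer G F : Subgroup Gᵐᵒᵖ) x (op g • x) →
    ∃ h ∈ (pointStabilizer G F : Subgroup Gᵐᵒᵖ),
      SameType (pointStabilizer G (insert k F) : Subgroup Gᵐᵒᵖ) x (h • op g • x)

/-- The one-point extension property of the types of a point. -/
def HasTypeExtension (G : Subgroup (Equiv.Perm ℕ)) {N : Type} [TopologicalSpace N]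
    [MulAction Gᵐᵒᵖ N] (x : N) : Prop :=
  ∀ (F : Finset ℕ) (k : ℕ) (g : G), ExtendsType F k g x

variable (hN : HasFiniteTypes Gᵐᵒᵖ N)
include hN

/-- Types over a finite set are locally constant, so nearby either the hypothesis still fails or the
same witness still works. -/
theorem isOpen_setOf_extendsType (F : Finset ℕ) (k : ℕ) (g : G) :
    IsOpen {x : N | ExtendsType F k g x} := by
  have := hN.continuousSMul
  refine isOpen_iff_mem_nhds.2 fun x hx => ?_
  by_cases h : SameType (pointStabilizer G F : Subgroup Gᵐᵒᵖ) x (op g • x)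
  · obtain ⟨u, hu, hux⟩ := hx h
    have hc : Continuous fun y : N => u • op g • y := by fun_prop
    filter_upwards [hN.setOf_sameType_mem_nhds (pointStabilizer G (insert k F)) x,
      hc.continuousAt.eventually_mem
        (hN.setOf_sameType_mem_nhds (pointStabilizer G (insert k F)) (u • op g • x))]
      with y hy hy' _
    exact ⟨u, hu, (SameType.symm hy).trans (hux.trans hy')⟩
  · have hc : Continuous fun y : N => op g • y := by fun_prop
    filter_upwards [hN.setOf_sameType_mem_nhds (pointStabilizer G F) x,
      hc.continuousAt.eventually_mem
        (hN.setOf_sameType_mem_nhds (pointStabilizer G F) (op g • x))] with y hy hy' hyy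
    exact absurd (SameType.trans hy (hyy.trans (SameType.symm hy'))) h

/-- If `x` and `op g • x` have the same type over `F`, amalgamation moves `x` slightly to a point
where the extension exists. -/
theorem dense_setOf_extendsType (F : Finset ℕ) (k : ℕ) (g : G) :
    Dense {x : N | ExtendsType F k g x} := by
  have := hN.continuousSMul
  refine dense_iff_inter_open.2 fun P hP ⟨x, hx⟩ => ?_
  by_cases h : SameType (pointStabilizer G F : Subgroup Gᵐᵒᵖ) x (op g • x)
  · have hc : Continuous fun y : N => (op g)⁻¹ • y := by fun_prop
    have hnear := hN.setOf_sameType_mem_nhds (pointStabilizer G (insert k F)) x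
    have hO : {w : N | (op g)⁻¹ • w ∈ P ∩ {y | SameType
        (pointStabilizer G (insert k F) : Subgroup Gᵐᵒᵖ) x y}} ∈ 𝓝 (op g • x) := by
      refine hc.continuousAt.eventually_mem ?_
      rw [inv_smul_smul]
      exact inter_mem (hP.mem_nhds hx) hnear
    obtain ⟨u, hu, w, ⟨hwP, hwx⟩, huw⟩ := hN.exists_smul_mem_of_sameType _ h.symm hO hnear
    refine ⟨(op g)⁻¹ • w, hwP, fun _ => ⟨u, hu, ?_⟩⟩
    rw [smul_inv_smul]
    exact (SameType.symm hwx).trans huw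
  · exact ⟨x, hx, fun h' => absurd h' h⟩

/-- The group may be uncountable, but the condition depends on `g` only through its restriction to
`F`, so countably many conditions suffice. -/
theorem setOf_hasTypeExtension_mem_residual : {x : N | HasTypeExtension G x} ∈ residual N := by
  have := hN.continuousSMul
  have key : ∀ (F : Finset ℕ) (k : ℕ) (f : F → ℕ),
      {x : N | ∀ g : G, (∀ i : F, g.1 i = f i) → ExtendsType F k g x} ∈ residual N := by
    intro F k f
    by_cases hf : ∃ g₀ : G, ∀ i : F, g₀.1 i = f i
    · obtain ⟨g₀, hg₀⟩ := hf
      refine mem_of_superset (residual_of_dense_open (isOpen_setOf_extendsType hN F k g₀)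
        (dense_setOf_extendsType hN F k g₀)) ?_
      intro x hx g hg hsame
      have hu : op (g⁻¹ * g₀) ∈ (pointStabilizer G F : Subgroup Gᵐᵒᵖ) := by
        intro i hi
        change g.1⁻¹ (g₀.1 i) = i
        rw [hg₀ ⟨i, hi⟩, ← hg ⟨i, hi⟩]
        simp
      have hxu : op g₀ • x = op (g⁻¹ * g₀) • op g • x := by
        rw [smul_smul, ← op_mul]
        simp
      have hsame' : SameType (pointStabilizer G F : Subgroup Gᵐᵒᵖ) x (op g₀ • x) := by
        rw [hxu]
        exact hsame.trans (sameType_smul hu _).symm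
      obtain ⟨h, hh, hhx⟩ := hx hsame'
      refine ⟨h * op (g⁻¹ * g₀), mul_mem hh hu, ?_⟩
      rwa [mul_smul, ← hxu]
    · exact Filter.mem_of_superset univ_mem fun x _ g hg => absurd ⟨g, hg⟩ hf
  have h1 : ∀ F : Finset ℕ, (⋂ k : ℕ, ⋂ f : F → ℕ,
      {x : N | ∀ g : G, (∀ i : F, g.1 i = f i) → ExtendsType F k g x}) ∈ residual N := fun F =>
    countable_iInter_mem.2 fun k => countable_iInter_mem.2 fun f => key F k f
  refine mem_of_superset (countable_iInter_mem.2 h1) fun x hx F k g => ?_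
  simp only [mem_iInter] at hx
  exact hx F k (fun i => g.1 i) g fun _ => rfl

theorem exists_hasTypeExtension : ∃ x : N, HasTypeExtension G x := by
  have := hN.compact
  have := hN.hausdorff
  have := hN.nonempty
  exact (dense_of_mem_residual (setOf_hasTypeExtension_mem_residual hN)).nonempty

end Extension

variable {L : FirstOrder.Language.{a, b}} [L.IsRelational] [L.Structure ℕ]
  {N : Type} [TopologicalSpace N] [MulAction (autGroup L)ᵐᵒᵖ N]
  (hN : HasFiniteTypes (autGroup L)ᵐᵒᵖ N) (hL : L.IsUltrahomogeneous ℕ)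
include hN hL

/-- For a countable structure it is enough to extend finite partial embeddings by one point. -/
theorem isUltrahomogeneous_typeExpansion {x : N} (hx : HasTypeExtension (autGroup L) x) :
    (L.sum (typeLanguage (autGroup L) N)).IsUltrahomogeneous (typeExpansion L x) := by
  have := hN.continuousSMul
  have : Countable (typeExpansion L x) := inferInstanceAs (Countable ℕ)
  rw [isUltrahomogeneous_iff_IsExtensionPair Structure.cg_of_countable,
    isExtensionPair_iff_exists_embedding_closure_singleton_sup]
  intro T hT f m
  let m' : ℕ := m
  have : Finite T := Substructure.fg_iff_finite.1 hT
  let F : Finset ℕ := rangeFinset (A := T) fun k => (k.1 : ℕ)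
  obtain ⟨g, hg, hgx⟩ := exists_sameType_of_embedding hL (A := T) T.subtype f F
    (exists_of_mem_rangeFinset (A := T) _)
  obtain ⟨h, hh, hhx⟩ := hx F m g hgx
  have hmem : ∀ k : (Substructure.closure _ {m} ⊔ T :
      (L.sum (typeLanguage (autGroup L) N)).Substructure (typeExpansion L x)),
      (k.1 : ℕ) ∈ (insert m' F : Finset ℕ) := by
    intro k
    have h1 : k.1 ∈ Substructure.closure (L.sum (typeLanguage (autGroup L) N)) ({m} ∪ (T : Set _)) := by
      rw [Substructure.closure_union, Substructure.closure_eq]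
      exact k.2
    rw [Substructure.mem_closure_iff_of_isRelational] at h1
    rcases h1 with h1 | h1
    · exact (Finset.mem_insert (α := ℕ)).2 (Or.inl h1)
    · exact Finset.mem_insert_of_mem (α := ℕ) (mem_rangeFinset (A := T) (fun k => (k.1 : ℕ)) ⟨k.1, h1⟩)
  -- In the opposite group the correction `h` is applied before `g`; it fixes `F`, so the corrected
  -- automorphism still extends `f`.
  have hgh : h • op g • x = op (g * h.unop) • x := by rw [op_mul, mul_smul, MulOpposite.op_unop]
  rw [hgh] at hhx
  obtain ⟨e, he⟩ := exists_embedding_of_sameType (Substructure.subtype _) (g * h.unop)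
    (insert m' F) hmem hhx
  refine ⟨e, Embedding.ext fun k => ?_⟩
  have h2 : e (Substructure.inclusion le_sup_right k) = g.1 (h.unop.1 (k.1 : ℕ)) := he _
  have h3 : h.unop.1 (k.1 : ℕ) = (k.1 : ℕ) := hh _ (mem_rangeFinset (A := T) (fun k => (k.1 : ℕ)) k)
  rw [h3] at h2
  exact (hg k).trans h2.symm

/-- Both expansions are Fraïssé limits of one class. An isomorphism between them is an automorphism
of the given structure that matches all types over finite sets, and these types separate points. -/
theorem mem_orbit_of_hasTypeExtension {x y : N} (hx : HasTypeExtension (autGroup L) x)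
    (hy : HasTypeExtension (autGroup L) y) : y ∈ MulAction.orbit (autGroup L)ᵐᵒᵖ x := by
  have : Countable (typeExpansion L x) := inferInstanceAs (Countable ℕ)
  have : Countable (typeExpansion L y) := inferInstanceAs (Countable ℕ)
  have hlx : IsFraisseLimit (typeAge L x) (typeExpansion L x) :=
    ⟨isUltrahomogeneous_typeExpansion hN hL hx, rfl⟩
  have hly : IsFraisseLimit (typeAge L x) (typeExpansion L y) :=
    ⟨isUltrahomogeneous_typeExpansion hN hL hy, age_typeExpansion_eq hN y x⟩
  obtain ⟨φ⟩ := hly.nonempty_equiv hlx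
  let ψ : ℕ ≃[L] ℕ :=
    { toEquiv := φ.toEquiv
      map_fun' := fun {_} f _ => isEmptyElim f
      map_rel' := fun {n} R t => φ.map_rel' (Sum.inl R) t }
  let g : autGroup L := ⟨ψ.toEquiv, ψ, rfl⟩
  refine ⟨op g, ?_⟩
  have h1 : typeStructure (autGroup L) (op g • x) = typeStructure (autGroup L) y := by
    rw [typeStructure_smul]
    apply FirstOrder.Language.Structure.ext
    · funext n f
      exact isEmptyElim f
    · funext n r t
      exact propext (φ.map_rel' (Sum.inr r) t)
  have := hN.continuousSMul
  refine hN.eq_of_sameType fun U => ?_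
  obtain ⟨F, hF⟩ := exists_pointStabilizer_le _ U
  refine SameType.mono hF ((sameType_iff_relMap F _ _).2 fun n r t _ => ?_)
  rw [h1]

theorem isExcellent_typeAge {x : N} (hx : HasTypeExtension (autGroup L) x) :
    IsExcellent (typeAge L x) (L.age ℕ) :=
  have : Countable (typeExpansion L x) := inferInstanceAs (Countable ℕ)
  { fraisse := (isUltrahomogeneous_typeExpansion hN hL hx).age_isFraisse
    expansion := isExpansionClass_typeAge hN hL x
    precompact := isPrecompact_typeAge hN hL x
    reasonable := isReasonable_typeAge hN hL x
    expansionProperty := hasExpansionProperty_typeAge hN hL x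
    ramsey := hasRamseyProperty_typeAge hN hL x }

/-- The expansion given by the types of a point, as a point of the space of expansions. -/
def toExpansionSpace (hN : HasFiniteTypes (autGroup L)ᵐᵒᵖ N) (x y : N) :
    ExpansionSpace (L := L) (typeAge L x) :=
  ⟨typeStructure (autGroup L) y, age_typeExpansion_subset hN y x⟩

omit hL in
theorem toExpansionSpace_smul (x y : N) (γ : (autGroup L)ᵐᵒᵖ) :
    toExpansionSpace hN x (γ • y) = γ • toExpansionSpace hN x y :=
  Subtype.ext (typeStructure_smul y γ.unop)

omit hL in
theorem injective_toExpansionSpace (x : N) : Function.Injective (toExpansionSpace hN x) := by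
  have := hN.continuousSMul
  intro y z hyz
  refine hN.eq_of_sameType fun U => ?_
  obtain ⟨F, hF⟩ := exists_pointStabilizer_le _ U
  refine SameType.mono hF ((sameType_iff_relMap F _ _).2 fun n r t _ => ?_)
  rw [show typeStructure (autGroup L) y = typeStructure (autGroup L) z from congrArg Subtype.val hyz]

omit hL in
theorem continuous_toExpansionSpace (x : N) : Continuous (toExpansionSpace hN x) := by
  have := hN.continuousSMul
  refine continuous_generateFrom_iff.2 ?_
  rintro _ ⟨F, t, rfl⟩
  refine isOpen_iff_mem_nhds.2 fun y hy => ?_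
  filter_upwards [hN.setOf_sameType_mem_nhds (pointStabilizer _ F) y] with z hz n r k hk
  exact ((sameType_iff_relMap F y z).1 hz n r k hk).symm.trans (hy n r k hk)

/-- On each finite set an expansion agrees with some point of `N`; the closed sets of such points
are directed, so compactness gives one point for all finite sets. -/
theorem surjective_toExpansionSpace (x : N) : Function.Surjective (toExpansionSpace hN x) := by
  have := hN.continuousSMul
  have := hN.compact
  rintro ⟨s, hs⟩
  let C : Finset ℕ → Set N := fun F => {y | ∀ (n : ℕ)
    (r : (typeLanguage (autGroup L) N).Relations n) (t : Fin n → ℕ), (∀ i, t i ∈ F) →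
      (s.RelMap r t ↔ (typeStructure (autGroup L) y).RelMap r t)}
  have hC : ∀ F y z, SameType (pointStabilizer (autGroup L) F : Subgroup (autGroup L)ᵐᵒᵖ) y z →
      y ∈ C F → z ∈ C F := fun F y z hyz hy n r t ht =>
    (hy n r t ht).trans ((sameType_iff_relMap F y z).1 hyz n r t ht)
  have hclosed : ∀ F, IsClosed (C F) := by
    intro F
    refine isOpen_compl_iff.1 (isOpen_iff_mem_nhds.2 fun y hy => ?_)
    filter_upwards [hN.setOf_sameType_mem_nhds (pointStabilizer _ F) y] with z hz hzC
    exact hy (hC F z y (SameType.symm hz) hzC)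
  have hne : ∀ F, (C F).Nonempty := by
    intro F
    let B : L.Substructure ℕ := Substructure.closure L F
    have hB : Structure.FG L B := (Substructure.fg_iff_structure_fg B).1
      (Substructure.fg_closure F.finite_toSet)
    have : Finite B := Structure.fg_iff_finite.1 hB
    have hmem : pullback s B.subtype ∈ expansions (typeAge L x) ⟨B, inferInstance⟩ := by
      refine hs ⟨?_, ⟨embeddingOfRel (fun k : B => (k.1 : ℕ)) Subtype.val_injective ?_⟩⟩
      · exact Structure.fg_iff_finite.2 (inferInstanceAs (Finite B))
      · rintro n (R | r) t
        · exact Iff.rfl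
        · exact Iff.rfl
    obtain ⟨y, hy⟩ := (mem_expansions_iff hN hL x ⟨B, inferInstance⟩ B.subtype _).1 hmem
    refine ⟨y, fun n r t ht => ?_⟩
    have h1 := congrArg (fun s' : (typeLanguage (autGroup L) N).Structure B =>
      s'.RelMap r fun i => ⟨t i, Substructure.subset_closure (ht i)⟩) hy
    exact iff_of_eq h1
  obtain ⟨y, hy⟩ := IsCompact.nonempty_iInter_of_directed_nonempty_isCompact_isClosed C
    (fun F F' => ⟨F ∪ F', fun y hy n r t ht => hy n r t fun i => Finset.mem_union_left _ (ht i),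
      fun y hy n r t ht => hy n r t fun i => Finset.mem_union_right _ (ht i)⟩)
    hne (fun F => (hclosed F).isCompact) hclosed
  refine ⟨y, Subtype.ext ?_⟩
  apply FirstOrder.Language.Structure.ext
  · funext n f
    exact isEmptyElim f
  · funext n r t
    exact propext ((mem_iInter.1 hy (tupleRange t) n r t (mem_tupleRange t)).symm)

end Limit

section UniversalFlow

/-! ### The universal minimal flow -/

open MulOpposite

theorem isMinimalFlow_uLift {G : Type*} [Group G] [TopologicalSpace G] {N : Type}
    [TopologicalSpace N] [MulAction Gᵐᵒᵖ N] [CompactSpace N] [T2Space N] [ContinuousSMul Gᵐᵒᵖ N]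
    [Nonempty N] [MulAction.IsMinimal Gᵐᵒᵖ N] : IsMinimalFlow G (ULift.{v} N) where
  compact := inferInstance
  hausdorff := inferInstance
  continuous := ⟨continuous_uliftUp.comp
    (continuous_fst.smul (continuous_uliftDown.comp continuous_snd))⟩
  nonempty := inferInstance
  minimal := by
    intro x
    have h1 : Dense (ULift.up '' MulAction.orbit Gᵐᵒᵖ x.down : Set (ULift.{v} N)) :=
      (ULift.up_surjective.denseRange).dense_image continuous_uliftUp
        (MulAction.dense_orbit Gᵐᵒᵖ x.down)
    refine h1.mono ?_
    rintro _ ⟨_, ⟨γ, rfl⟩, rfl⟩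
    exact ⟨γ, rfl⟩

/-- A minimal subflow of the greatest ambit is a quotient of the metrizable flow, hence has
countably many clopen sets. -/
theorem exists_hasFiniteTypes (G : Type) [Group G] [TopologicalSpace G] [NonarchimedeanGroup Gᵐᵒᵖ]
    (h : HasMetrizableUniversalMinimalFlow.{0, v} G) :
    ∃ (N : Type) (_ : TopologicalSpace N) (_ : MulAction Gᵐᵒᵖ N), HasFiniteTypes Gᵐᵒᵖ N ∧
      ∀ (Y : Type v) [TopologicalSpace Y] [MulAction Gᵐᵒᵖ Y], IsMinimalFlow G Y →
        ∃ f : N → Y, IsFlowMap Gᵐᵒᵖ f := by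
  obtain ⟨Z, hZsub, hZc, hZn, hZm⟩ := exists_minimal_subflow
    (closure (MulAction.orbit Gᵐᵒᵖ (Ambit.base : Ambit Gᵐᵒᵖ))) isClosed_closure
    (MulAction.nonempty_orbit _).closure
    (fun γ q hq => smul_closure_orbit_subset γ _ ⟨q, hq, rfl⟩)
  have : CompactSpace Z := isCompact_iff_compactSpace.1 hZc.isCompact
  have : T2Space Z := inferInstanceAs (T2Space (Z : Set (Ambit Gᵐᵒᵖ)))
  obtain ⟨M, _, _, hM, _⟩ := h
  have := hM.isMinimalFlow.compact
  have := hM.isMinimalFlow.nonempty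
  obtain ⟨f, hf⟩ := hM.universal (ULift.{v} Z) isMinimalFlow_uLift
  let f' : M → Z := fun x => (f x).down
  have hf' : IsFlowMap Gᵐᵒᵖ f' :=
    ⟨continuous_uliftDown.comp hf.1, fun γ x => congrArg ULift.down (hf.2 γ.unop x)⟩
  let := TopologicalSpace.metrizableSpaceMetric M
  have hc := countable_clopens_of_surjective hf'.1 hf'.surjective countable_clopens
  refine ⟨Z, inferInstance, inferInstance,
    hasFiniteTypes_of_countable_clopens Z hZc hZn hZm hZsub hc, ?_⟩
  intro Y _ _ hY
  have := hY.compact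
  have := hY.hausdorff
  have := hY.continuous
  obtain ⟨y⟩ := hY.nonempty
  obtain ⟨f, hf, -⟩ := Ambit.exists_map y Z hZsub
  exact ⟨f, hf⟩

/-- The composite of `f` with a map back to `N` is a self-map of `N`, hence injective, so `f` is
injective too. -/
theorem exists_homeomorph_of_isUniversalMinimalFlow {G : Type} [Group G] [TopologicalSpace G]
    [NonarchimedeanGroup Gᵐᵒᵖ] {N : Type} [TopologicalSpace N] [MulAction Gᵐᵒᵖ N]
    (hN : HasFiniteTypes Gᵐᵒᵖ N) {M : Type v} [TopologicalSpace M] [MulAction Gᵐᵒᵖ M]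
    (hM : IsUniversalMinimalFlow G M) (f : N → M) (hf : IsFlowMap Gᵐᵒᵖ f) :
    ∃ φ : N ≃ₜ M, IsFlowMap Gᵐᵒᵖ φ := by
  have := hN.compact
  have := hN.hausdorff
  have := hN.nonempty
  have := hN.minimal
  have := hN.continuousSMul
  have := hM.isMinimalFlow.hausdorff
  have : MulAction.IsMinimal Gᵐᵒᵖ M := ⟨hM.isMinimalFlow.minimal⟩
  obtain ⟨g, hg⟩ := hM.universal (ULift.{v} N) isMinimalFlow_uLift
  have hgf : IsFlowMap Gᵐᵒᵖ fun x => (g (f x)).down :=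
    ⟨continuous_uliftDown.comp (hg.1.comp hf.1), fun γ x => by
      change (g (f (γ • x))).down = _
      rw [hf.2]
      exact congrArg ULift.down (hg.2 γ.unop _)⟩
  have hinj : Function.Injective f := fun x y hxy =>
    hN.injective_of_isFlowMap hgf (by simp only [hxy])
  exact ⟨Continuous.homeoOfEquivCompactToT2 (f := Equiv.ofBijective f ⟨hinj, hf.surjective⟩) hf.1,
    hf⟩

theorem preimage_mem_residual {X Y : Type*} [TopologicalSpace X] [TopologicalSpace Y] (e : X ≃ₜ Y)
    {A : Set Y} (hA : A ∈ residual Y) : e ⁻¹' A ∈ residual X :=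
  tendsto_residual_of_isOpenMap e.continuous e.isOpenMap hA

end UniversalFlow

/-! ### The universal minimal flow as a space of expansions -/

section Main

open FirstOrder FirstOrder.Language MulOpposite

instance {L : FirstOrder.Language.{a, b}} [L.Structure ℕ] {S : FirstOrder.Language.{0, 0}}
    [S.IsRelational] (𝒦s : Set (Bundled.{0} (L.sum S).Structure)) :
    T2Space (ExpansionSpace 𝒦s) where
  t2 s t hst := by
    have hopen : ∀ F u, IsOpen (ExpansionSpace.basicOpen (𝒦s := 𝒦s) F u) := fun F u =>
      TopologicalSpace.isOpen_generateFrom_of_mem ⟨F, u, rfl⟩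
    obtain ⟨n, r, k, hk⟩ : ∃ (n : ℕ) (r : S.Relations n) (k : Fin n → ℕ),
        ¬(s.1.RelMap r k ↔ t.1.RelMap r k) := by
      by_contra! hcon
      refine hst (Subtype.ext (FirstOrder.Language.Structure.ext ?_ ?_))
      · funext n f
        exact isEmptyElim f
      · funext n r k
        exact propext (hcon n r k)
    refine ⟨_, _, hopen (tupleRange k) s, hopen (tupleRange k) t, fun _ _ _ _ => Iff.rfl,
      fun _ _ _ _ => Iff.rfl, disjoint_left.2 fun u hu hu' => hk ?_⟩
    exact (hu n r k (mem_tupleRange k)).symm.trans (hu' n r k (mem_tupleRange k))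

theorem exists_excellent_expansion (L : FirstOrder.Language.{a, b}) [L.IsRelational] [L.Structure ℕ]
    (hL : L.IsUltrahomogeneous ℕ) (h : HasMetrizableUniversalMinimalFlow.{0, v} (autGroup L)) :
    ∃ (S : FirstOrder.Language.{0, 0}) (_ : S.IsRelational) (_ : Countable S.Symbols)
      (𝒦s : Set (Bundled.{0} (L.sum S).Structure)),
      IsExcellent 𝒦s (L.age ℕ) ∧
      ∃ s : ExpansionSpace 𝒦s, IsLimit s ∧
        ∀ (M : Type v) [TopologicalSpace M] [MulAction (autGroup L)ᵐᵒᵖ M],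
          IsUniversalMinimalFlow (autGroup L) M →
          ∃ φ : ExpansionSpace 𝒦s ≃ₜ M, IsGMap (autGroup L) φ ∧
            ∀ y : M, HasGenericOrbit (autGroup L) y ↔
              y ∈ MulAction.orbit (autGroup L)ᵐᵒᵖ (φ s) := by
  obtain ⟨N, _, _, hN, huniv⟩ := exists_hasFiniteTypes (autGroup L) h
  have := hN.compact
  have := hN.hausdorff
  obtain ⟨x, hx⟩ := exists_hasTypeExtension hN
  let θ : N ≃ₜ ExpansionSpace (typeAge L x) := Continuous.homeoOfEquivCompactToT2
    (f := Equiv.ofBijective (toExpansionSpace hN x)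
      ⟨injective_toExpansionSpace hN x, surjective_toExpansionSpace hN hL x⟩)
    (continuous_toExpansionSpace hN x)
  refine ⟨typeLanguage (autGroup L) N, inferInstance, countable_typeLanguage hN, typeAge L x,
    isExcellent_typeAge hN hL hx, θ x, ⟨isUltrahomogeneous_typeExpansion hN hL hx, rfl⟩, ?_⟩
  intro M _ _ hM
  obtain ⟨f, hf⟩ := huniv M hM.isMinimalFlow
  obtain ⟨ψ, hψ⟩ := exists_homeomorph_of_isUniversalMinimalFlow hN hM f hf
  have := hM.isMinimalFlow.hausdorff
  have := hM.isMinimalFlow.compact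
  have := hM.isMinimalFlow.nonempty
  have hgen : MulAction.orbit (autGroup L)ᵐᵒᵖ (ψ x) ∈ residual M := by
    refine mem_of_superset (preimage_mem_residual ψ.symm (setOf_hasTypeExtension_mem_residual hN)) ?_
    intro y hy
    obtain ⟨γ, hγ⟩ := mem_orbit_of_hasTypeExtension hN hL hx hy
    refine ⟨γ, ?_⟩
    change γ • ψ x = y
    rw [← hψ.2, show γ • x = ψ.symm y from hγ, ψ.apply_symm_apply]
  refine ⟨θ.symm.trans ψ, ⟨(θ.symm.trans ψ).continuous, fun g s => ?_⟩, fun y => ?_⟩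
  · obtain ⟨y, rfl⟩ := θ.surjective s
    have h1 : op g • θ y = θ (op g • y) := (toExpansionSpace_smul hN x y (op g)).symm
    rw [h1]
    simp only [Homeomorph.trans_apply, Homeomorph.symm_apply_apply]
    exact hψ.2 _ _
  · have h1 : (θ.symm.trans ψ) (θ x) = ψ x := by simp
    rw [h1]
    constructor
    · intro hy
      -- Two comeager orbits in a nonempty Baire space meet, so they coincide.
      obtain ⟨z, hz1, hz2⟩ := (dense_of_mem_residual (inter_mem hy hgen)).nonempty
      rw [← MulAction.orbit_eq_iff.2 hz2, MulAction.orbit_eq_iff.2 hz1]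
      exact MulAction.mem_orbit_self y
    · intro hy
      rw [HasGenericOrbit, MulAction.orbit_eq_iff.2 hy]
      exact hgen

end Main

section ClosedSubgroups

/-! ### Closed permutation groups as automorphism groups -/

open FirstOrder FirstOrder.Language

theorem isClosed_autGroup (L : FirstOrder.Language.{a, b}) [L.IsRelational] [L.Structure ℕ] :
    IsClosed (autGroup L : Set (Equiv.Perm ℕ)) := by
  refine isClosed_of_closure_subset fun g hg => ?_
  refine ⟨{ toEquiv := g, map_fun' := fun {_} f _ => isEmptyElim f, map_rel' := ?_ }, rfl⟩
  intro n R t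
  obtain ⟨h, hh, hG⟩ := mem_closure_iff_nhds.1 hg _
    (mem_nhds_perm_iff.2 ⟨tupleRange t, Subset.rfl⟩)
  have h1 : (g ∘ t : Fin n → ℕ) = h ∘ t := funext fun i => (hh _ (mem_tupleRange t i)).symm
  change Structure.RelMap R (g ∘ t) ↔ _
  rw [h1]
  exact autGroup_relMap ⟨h, hG⟩ R t

/-- The language with a relation symbol for each tuple. -/
def orbitLanguage : FirstOrder.Language.{0, 0} where
  Functions _ := Empty
  Relations n := Fin n → ℕ

instance : orbitLanguage.IsRelational := fun _ => inferInstanceAs (IsEmpty Empty)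

/-- The structure whose relations are the orbits of a group of permutations on tuples. -/
@[reducible]
def orbitStructure (G : Subgroup (Equiv.Perm ℕ)) : orbitLanguage.Structure ℕ where
  funMap := fun f => isEmptyElim f
  RelMap := fun r t => ∃ g : G, g.1 ∘ r = t

theorem mem_autGroup_orbitStructure {G : Subgroup (Equiv.Perm ℕ)} (g : G) :
    letI := orbitStructure G
    g.1 ∈ autGroup orbitLanguage := by
  let := orbitStructure G
  refine ⟨{ toEquiv := g.1, map_fun' := fun {_} f _ => isEmptyElim f, map_rel' := ?_ }, rfl⟩
  intro n r t
  constructor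
  · rintro ⟨h, hh⟩
    refine ⟨g⁻¹ * h, funext fun i => ?_⟩
    have h1 : h.1 (r i) = g.1 (t i) := congrFun hh i
    change g.1⁻¹ (h.1 (r i)) = t i
    rw [h1]
    simp
  · rintro ⟨h, rfl⟩
    exact ⟨g * h, rfl⟩

/-- An automorphism preserves the orbit of every tuple, so on each finite set it agrees with an
element of `G`; closedness then puts it in `G`. -/
theorem autGroup_orbitStructure {G : Subgroup (Equiv.Perm ℕ)}
    (hG : IsClosed (G : Set (Equiv.Perm ℕ))) :
    letI := orbitStructure G
    autGroup orbitLanguage = G := by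
  let := orbitStructure G
  refine le_antisymm ?_ fun g hg => mem_autGroup_orbitStructure ⟨g, hg⟩
  intro g hg
  refine hG.closure_subset (mem_closure_iff_nhds.2 fun W hW => ?_)
  obtain ⟨F, hF⟩ := mem_nhds_perm_iff.1 hW
  obtain ⟨n, t, rfl⟩ := exists_tupleRange_eq F
  obtain ⟨h, hh⟩ := (autGroup_relMap ⟨g, hg⟩ (L := orbitLanguage) (n := n) t t).2 ⟨1, rfl⟩
  refine ⟨h.1, hF fun k hk => ?_, h.2⟩
  obtain ⟨i, rfl⟩ := mem_tupleRange_iff.1 hk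
  exact congrFun hh i

/-- An embedding of a finite substructure keeps an enumerating tuple in its orbit, so it is the
restriction of an element of `G`. -/
theorem isUltrahomogeneous_orbitStructure (G : Subgroup (Equiv.Perm ℕ)) :
    letI := orbitStructure G
    orbitLanguage.IsUltrahomogeneous ℕ := by
  let := orbitStructure G
  intro T hT f
  have : Finite T := Substructure.fg_iff_finite.1 hT
  obtain ⟨n, t, ht⟩ := exists_tupleRange_eq (rangeFinset fun k : T => (k : ℕ))
  have hmem : ∀ i, ∃ k : T, (k : ℕ) = t i := fun i =>
    exists_of_mem_rangeFinset _ _ (ht ▸ mem_tupleRange t i)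
  choose d hd using hmem
  obtain ⟨h, hh⟩ := (f.map_rel' (n := n) t d).2 ⟨1, funext fun i => (hd i).symm⟩
  obtain ⟨φ, hφ⟩ := mem_autGroup_orbitStructure h
  refine ⟨φ, Embedding.ext fun k => ?_⟩
  obtain ⟨i, hi⟩ := mem_tupleRange_iff.1 (ht ▸ mem_rangeFinset (fun k : T => (k : ℕ)) k)
  have h1 : d i = k := Subtype.ext ((hd i).trans hi)
  have h2 : h.1 (t i) = f (d i) := congrFun hh i
  rw [h1, hi, ← hφ] at h2
  exact h2.symm

theorem isClosed_iff_exists_isUltrahomogeneous (G : Subgroup (Equiv.Perm ℕ)) :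
    IsClosed (G : Set (Equiv.Perm ℕ)) ↔
      ∃ (L : FirstOrder.Language.{0, 0}) (_ : L.IsRelational) (_ : L.Structure ℕ),
        L.IsUltrahomogeneous ℕ ∧ autGroup L = G := by
  constructor
  · intro hG
    exact ⟨orbitLanguage, inferInstance, orbitStructure G, isUltrahomogeneous_orbitStructure G,
      autGroup_orbitStructure hG⟩
  · rintro ⟨L, _, _, -, rfl⟩
    exact isClosed_autGroup L

theorem genericPointProperty_of_isClosed (G : Subgroup (Equiv.Perm ℕ))
    (hG : IsClosed (G : Set (Equiv.Perm ℕ))) (h : HasMetrizableUniversalMinimalFlow.{0, v} G) :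
    GenericPointProperty.{0, v} G := by
  obtain ⟨L, _, _, hL, rfl⟩ := (isClosed_iff_exists_isUltrahomogeneous G).1 hG
  obtain ⟨S, _, _, 𝒦s, -, s, -, hs⟩ := exists_excellent_expansion L hL h
  obtain ⟨M, _, _, hM, -⟩ := h
  refine ⟨⟨M, _, _, hM⟩, fun M' _ _ hM' => ?_⟩
  obtain ⟨φ, -, hφ⟩ := hs M' hM'
  exact ⟨φ s, (hφ _).2 (MulAction.mem_orbit_self _)⟩

end ClosedSubgroups

section Transfer

/-! ### Transfer of flows along isomorphisms of topological groups -/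

open MulOpposite

/-- The action obtained from an isomorphism of groups. -/
@[reducible]
def transferAction {G H : Type*} [Group G] [Group H] (e : H ≃* G) (M : Type*)
    [MulAction Gᵐᵒᵖ M] : MulAction Hᵐᵒᵖ M :=
  MulAction.compHom M (MulEquiv.op e).toMonoidHom

variable {G H : Type*} [Group G] [Group H] [TopologicalSpace G] [TopologicalSpace H]

theorem orbit_transferAction (e : H ≃* G) {M : Type*} [MulAction Gᵐᵒᵖ M] (x : M) :
    letI := transferAction e M
    MulAction.orbit Hᵐᵒᵖ x = MulAction.orbit Gᵐᵒᵖ x := by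
  let := transferAction e M
  ext y
  constructor
  · rintro ⟨γ, rfl⟩
    exact ⟨op (e γ.unop), rfl⟩
  · rintro ⟨γ, rfl⟩
    refine ⟨op (e.symm γ.unop), ?_⟩
    change op (e (e.symm γ.unop)) • x = γ • x
    simp

theorem isMinimalFlow_transferAction (e : H ≃* G) (he : Continuous e) {M : Type v}
    [TopologicalSpace M] [MulAction Gᵐᵒᵖ M] (h : IsMinimalFlow G M) :
    letI := transferAction e M
    IsMinimalFlow H M := by
  let := transferAction e M
  refine ⟨h.compact, h.hausdorff, ⟨?_⟩, h.nonempty, fun x => ?_⟩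
  · have := h.continuous
    have hc : Continuous fun q : Hᵐᵒᵖ × M => op (e q.1.unop) • q.2 :=
      (continuous_op.comp (he.comp (continuous_unop.comp continuous_fst))).smul continuous_snd
    exact hc
  · rw [orbit_transferAction e x]
    exact h.minimal x

theorem isUniversalMinimalFlow_transferAction (e : H ≃* G) (he : Continuous e)
    (he' : Continuous e.symm) {M : Type v} [TopologicalSpace M] [MulAction Gᵐᵒᵖ M]
    (h : IsUniversalMinimalFlow G M) :
    letI := transferAction e M
    IsUniversalMinimalFlow H M := by
  let := transferAction e M
  refine ⟨isMinimalFlow_transferAction e he h.isMinimalFlow, fun Y _ _ hY => ?_⟩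
  let := transferAction e.symm Y
  obtain ⟨f, hf⟩ := h.universal Y (isMinimalFlow_transferAction e.symm he' hY)
  refine ⟨f, hf.1, fun g x => (hf.2 (e g) x).trans ?_⟩
  change op (e.symm (e g)) • f x = op g • f x
  rw [e.symm_apply_apply]

theorem genericPointProperty_of_mulEquiv (e : H ≃* G) (he : Continuous e)
    (he' : Continuous e.symm)
    (hG : HasMetrizableUniversalMinimalFlow.{_, v} G → GenericPointProperty.{_, v} G)
    (h : HasMetrizableUniversalMinimalFlow.{_, v} H) : GenericPointProperty.{_, v} H := by
  obtain ⟨M, _, _, hM, hmet⟩ := h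
  refine ⟨⟨M, _, _, hM⟩, fun M' _ _ hM' => ?_⟩
  let := transferAction e.symm M'
  obtain ⟨x, hx⟩ := (hG ⟨M, _, transferAction e.symm M,
    isUniversalMinimalFlow_transferAction e.symm he' he hM, hmet⟩).2 M'
    (isUniversalMinimalFlow_transferAction e.symm he' he hM')
  refine ⟨x, ?_⟩
  rw [HasGenericOrbit] at hx ⊢
  rwa [orbit_transferAction e.symm x] at hx

end Transfer

section Polish

/-! ### Nonarchimedean Polish groups as closed permutation groups -/

/-- `W n` consists of the points with a neighbourhood whose trace on `X` has small diameter; it is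
open and contains the dense range. At a point of every `W n` the trace of the neighbourhood filter
is Cauchy, and its limit maps to that point. -/
theorem range_mem_residual {X Y : Type*} [TopologicalSpace X] [TopologicalSpace Y]
    [TopologicalSpace.IsCompletelyMetrizableSpace X] [T2Space Y] {ι : X → Y} (hι : IsInducing ι)
    (hd : DenseRange ι) : range ι ∈ residual Y := by
  let := TopologicalSpace.upgradeIsCompletelyMetrizable X
  let W : ℕ → Set Y := fun n => {q | ∃ O, IsOpen O ∧ q ∈ O ∧
    ∀ x y, ι x ∈ O → ι y ∈ O → dist x y < 1 / (n + 1)}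
  have hWo : ∀ n, IsOpen (W n) := fun n => isOpen_iff_mem_nhds.2 fun q ⟨O, hO, hq, h⟩ =>
    mem_of_superset (hO.mem_nhds hq) fun q' hq' => ⟨O, hO, hq', h⟩
  have hWd : ∀ n, Dense (W n) := fun n => hd.mono (by
    rintro _ ⟨x, rfl⟩
    obtain ⟨O, hO, hOx⟩ := hι.isOpen_iff.1 (Metric.isOpen_ball (x := x) (ε := 1 / (n + 1) / 2))
    have hmem : ∀ y, ι y ∈ O ↔ y ∈ Metric.ball x (1 / ((n : ℝ) + 1) / 2) := fun y => by
      rw [← hOx]; rfl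
    refine ⟨O, hO, (hmem x).2 (Metric.mem_ball_self (by positivity)), fun y z hy hz => ?_⟩
    have h1 := Metric.mem_ball.1 ((hmem y).1 hy)
    have h2 := Metric.mem_ball.1 ((hmem z).1 hz)
    have h3 := dist_triangle_right y z x
    linarith)
  refine mem_of_superset (countable_iInter_mem.2 fun n =>
    residual_of_dense_open (hWo n) (hWd n)) fun q hq => ?_
  have hne : (comap ι (𝓝 q)).NeBot := comap_neBot fun t ht => by
    obtain ⟨_, hx, x, rfl⟩ := mem_closure_iff_nhds.1 (hd q) t ht
    exact ⟨x, hx⟩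
  have hcauchy : Cauchy (comap ι (𝓝 q)) := by
    refine Metric.cauchy_iff.2 ⟨hne, fun ε hε => ?_⟩
    obtain ⟨n, hn⟩ := exists_nat_one_div_lt hε
    obtain ⟨O, hO, hqO, h⟩ := mem_iInter.1 hq n
    exact ⟨ι ⁻¹' O, preimage_mem_comap (hO.mem_nhds hqO), fun x hx y hy => (h x y hx hy).trans hn⟩
  obtain ⟨x, hx⟩ := CompleteSpace.complete hcauchy
  refine ⟨x, ?_⟩
  have h1 : map ι (comap ι (𝓝 q)) ≤ 𝓝 (ι x) := (map_mono hx).trans hι.continuous.continuousAt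
  exact eq_of_nhds_neBot ((map_neBot (hf := hne)).mono (le_inf h1 map_comap_le))

/-- A completely metrizable subgroup of a Polish group is closed. -/
theorem isClosed_range_of_isInducing {H P : Type*} [Group H] [TopologicalSpace H] [PolishSpace H]
    [Group P] [TopologicalSpace P] [IsTopologicalGroup P] [PolishSpace P] (ρ : H →* P)
    (hρ : IsInducing ρ) : IsClosed (ρ.range : Set P) := by
  let C : Subgroup P := ρ.range.topologicalClosure
  have hC : IsClosed (C : Set P) := Subgroup.isClosed_topologicalClosure _
  have : PolishSpace C := hC.polishSpace
  let ι : H → C := fun h => ⟨ρ h, Subgroup.le_topologicalClosure _ ⟨h, rfl⟩⟩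
  have hι : IsInducing ι := IsInducing.of_comp (f := ι) (g := Subtype.val)
    (Continuous.subtype_mk hρ.continuous _) continuous_subtype_val hρ
  have hd : DenseRange ι := by
    rintro ⟨g, hg⟩
    rw [closure_subtype]
    refine closure_mono ?_ hg
    rintro _ ⟨h, rfl⟩
    exact ⟨ι h, ⟨h, rfl⟩, rfl⟩
  have hres := range_mem_residual hι hd
  refine isClosed_of_closure_subset fun g hg => ?_
  let g' : C := ⟨g, hg⟩
  -- The image of `H` and its coset by `g` are both comeager in the closure, so they meet and `g` is
  -- in the image.
  have hres' := preimage_mem_residual (Homeomorph.mulLeft g'⁻¹) hres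
  let := TopologicalSpace.upgradeIsCompletelyMetrizable C
  have : Nonempty C := ⟨1⟩
  obtain ⟨q, ⟨h, hq⟩, h', hq'⟩ := (dense_of_mem_residual (inter_mem hres hres')).nonempty
  have h1 : ρ h = q.1 := congrArg Subtype.val hq
  have h2 : ρ h' = g⁻¹ * q.1 := congrArg Subtype.val hq'
  refine ⟨h * h'⁻¹, ?_⟩
  rw [map_mul, map_inv, h1, h2]
  group

/-- Permutations need not be closed in `ℕ → ℕ`, but the pairs `(g, g⁻¹)` form a closed subset of the
square. -/
instance : PolishSpace (Equiv.Perm ℕ) := by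
  let f : Equiv.Perm ℕ → (ℕ → ℕ) × (ℕ → ℕ) := fun g => (g, (g⁻¹ : Equiv.Perm ℕ))
  have hcoe : Continuous fun g : Equiv.Perm ℕ => (g : ℕ → ℕ) := continuous_induced_dom
  have hf : Continuous f := hcoe.prodMk (hcoe.comp continuous_inv)
  have hind : IsInducing f := IsInducing.of_comp (g := Prod.fst) hf continuous_fst ⟨rfl⟩
  have hinj : Function.Injective f := fun g h hgh => DFunLike.coe_injective (congrArg Prod.fst hgh)
  have hrange : range f = {q | ∀ k, q.1 (q.2 k) = k ∧ q.2 (q.1 k) = k} := by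
    ext q
    constructor
    · rintro ⟨g, rfl⟩ k
      simp [f]
    · intro hq
      exact ⟨⟨q.1, q.2, fun k => (hq k).2, fun k => (hq k).1⟩, rfl⟩
  have hclosed : IsClosed (range f) := by
    rw [hrange]
    have heval : Continuous fun p : (ℕ → ℕ) × ℕ => p.1 p.2 := by
      refine continuous_iff_continuousAt.2 ?_
      rintro ⟨p, k⟩
      have h1 : ContinuousAt (fun q : (ℕ → ℕ) × ℕ => q.1 k) (p, k) :=
        ((continuous_apply k).comp continuous_fst).continuousAt
      refine h1.congr ?_
      have h2 : ∀ᶠ q : (ℕ → ℕ) × ℕ in 𝓝 (p, k), q.2 = k :=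
        continuous_snd.continuousAt.eventually_mem (mem_nhds_discrete.2 (mem_singleton _))
      filter_upwards [h2] with q hq
      rw [hq]
    have h1 : ∀ k, Continuous fun q : (ℕ → ℕ) × (ℕ → ℕ) => q.1 (q.2 k) := fun k =>
      heval.comp (continuous_fst.prodMk ((continuous_apply k).comp continuous_snd))
    have h2 : ∀ k, Continuous fun q : (ℕ → ℕ) × (ℕ → ℕ) => q.2 (q.1 k) := fun k =>
      heval.comp (continuous_snd.prodMk ((continuous_apply k).comp continuous_fst))
    have h3 : {q : (ℕ → ℕ) × (ℕ → ℕ) | ∀ k, q.1 (q.2 k) = k ∧ q.2 (q.1 k) = k} =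
        ⋂ k, ({q | q.1 (q.2 k) = k} ∩ {q | q.2 (q.1 k) = k}) := by
      ext q
      simp
    rw [h3]
    exact isClosed_iInter fun k => (isClosed_eq (h1 k) continuous_const).inter
      (isClosed_eq (h2 k) continuous_const)
  exact IsClosedEmbedding.polishSpace ⟨⟨hind, hinj⟩, hclosed⟩

theorem countable_quotient_openSubgroup {H : Type*} [Group H] [TopologicalSpace H]
    [IsTopologicalGroup H] [TopologicalSpace.SeparableSpace H] (U : OpenSubgroup H) :
    Countable (H ⧸ (U : Subgroup H)) := by
  obtain ⟨D, hD, hdense⟩ := TopologicalSpace.exists_countable_dense H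
  have := hD.to_subtype
  have := QuotientGroup.discreteTopology U.isOpen
  refine Function.Surjective.countable (f := fun d : D => (QuotientGroup.mk d.1 : H ⧸ (U : Subgroup H))) ?_
  intro q
  obtain ⟨h, rfl⟩ := QuotientGroup.mk_surjective q
  have hopen : IsOpen {x : H | (QuotientGroup.mk x : H ⧸ (U : Subgroup H)) = QuotientGroup.mk h} :=
    (isOpen_discrete {(QuotientGroup.mk h : H ⧸ (U : Subgroup H))}).preimage
      QuotientGroup.continuous_mk
  obtain ⟨d, hd, hdD⟩ := hdense.inter_open_nonempty _ hopen ⟨h, rfl⟩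
  exact ⟨⟨d, hdD⟩, hd⟩

/-- `H` acts on the countable disjoint union of the `H ⧸ U n`, for `U n` a neighbourhood basis of
open subgroups. Point stabilizers are open, and those of the trivial cosets are the `U n`, so the
action is a topological embedding; its image is closed because `H` is Polish. -/
theorem exists_mulEquiv_closed_subgroup (H : Type u) [Group H] [TopologicalSpace H]
    [NonarchimedeanGroup H] [PolishSpace H] :
    ∃ G : Subgroup (Equiv.Perm ℕ), IsClosed (G : Set (Equiv.Perm ℕ)) ∧
      ∃ e : H ≃* G, Continuous e ∧ Continuous e.symm := by
  obtain ⟨W, hW⟩ := (𝓝 (1 : H)).exists_antitone_basis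
  choose U hU using fun n => NonarchimedeanGroup.is_nonarchimedean (W n) (hW.mem n)
  let X : Type u := Σ n, H ⧸ (U n : Subgroup H)
  have hcount : ∀ n, Countable (H ⧸ (U n : Subgroup H)) := fun n =>
    countable_quotient_openSubgroup (U n)
  have : Countable X := inferInstanceAs (Countable (Σ n, H ⧸ (U n : Subgroup H)))
  -- The index `n` makes `X` infinite even when the coset spaces are finite, so `X` can be
  -- identified with `ℕ`.
  have : Infinite X := Infinite.of_injective
    (fun n : ℕ => (⟨n, QuotientGroup.mk 1⟩ : X)) fun m n hmn => congrArg Sigma.fst hmn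
  obtain ⟨ε⟩ := nonempty_equiv_of_countable (α := X) (β := ℕ)
  let ρ : H →* Equiv.Perm ℕ := ε.permCongrHom.toMonoidHom.comp (MulAction.toPermHom H X)
  have hρ : ∀ h k, ρ h k = ε (h • ε.symm k) := fun h k => rfl
  have hstab : ∀ (x : X), ∀ᶠ h in 𝓝 (1 : H), h • x = x := by
    rintro ⟨n, q⟩
    have := QuotientGroup.discreteTopology (U n).isOpen
    have hc : Continuous fun h : H => h • q := by fun_prop
    have : ∀ᶠ h in 𝓝 (1 : H), h • q = q := by
      refine hc.continuousAt.eventually_mem (s := {q}) (mem_nhds_discrete.2 ?_)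
      rw [one_smul]
      exact mem_singleton _
    filter_upwards [this] with h hh
    exact congrArg (Sigma.mk n) hh
  have hnhds : 𝓝 (1 : H) = comap ρ (𝓝 1) := by
    refine le_antisymm ?_ ?_
    · rw [← tendsto_iff_comap]
      intro T hT
      obtain ⟨F, hF⟩ := mem_nhds_perm_iff.1 hT
      have : ∀ᶠ h in 𝓝 (1 : H), ∀ k ∈ F, h • ε.symm k = ε.symm k :=
        (Filter.eventually_all_finset F).2 fun k _ => hstab _
      refine mem_map.2 (mem_of_superset this fun h hh => hF fun k hk => ?_)
      rw [hρ, hh k hk]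
      simp
    · intro T hT
      obtain ⟨n, -, hn⟩ := hW.1.mem_iff.1 hT
      let x : X := ⟨n, QuotientGroup.mk 1⟩
      refine mem_comap.2 ⟨{g | g (ε x) = ε x}, eventually_perm_apply_eq 1 _, fun h hh => ?_⟩
      have h1 : ε (h • ε.symm (ε x)) = ε x := hh
      rw [ε.symm_apply_apply, ε.apply_eq_iff_eq] at h1
      have h2 : (QuotientGroup.mk (h * 1) : H ⧸ (U n : Subgroup H)) = QuotientGroup.mk 1 :=
        eq_of_heq (Sigma.mk.inj h1).2
      rw [mul_one, eq_comm, QuotientGroup.eq] at h2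
      exact hn (hU n (by simpa using h2))
  have hind : IsInducing ρ := by
    refine isInducing_iff_nhds.2 fun h => ?_
    have h1 := (Homeomorph.mulLeft h⁻¹).isInducing.nhds_eq_comap h
    have h2 := (Homeomorph.mulLeft (ρ h)⁻¹).isInducing.nhds_eq_comap (ρ h)
    simp only [Homeomorph.coe_mulLeft, inv_mul_cancel] at h1 h2
    rw [h1, h2, hnhds, comap_comap, comap_comap]
    congr 1
    funext x
    simp
  have hinj : Function.Injective ρ := hind.injective
  refine ⟨ρ.range, isClosed_range_of_isInducing ρ hind, MonoidHom.ofInjective hinj, ?_, ?_⟩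
  · exact Continuous.subtype_mk hind.continuous _
  · have h1 : IsInducing (MonoidHom.ofInjective hinj) := IsInducing.of_comp
      (g := Subtype.val) (Continuous.subtype_mk hind.continuous _) continuous_subtype_val hind
    refine h1.continuous_iff.2 ?_
    convert continuous_id using 1
    funext x
    simp

end Polish

end Dynamics

theorem corollary8p15 :
    -- closed subgroups of the group of permutations of `ℕ`
    (∀ G : Subgroup (Equiv.Perm ℕ), IsClosed (G : Set (Equiv.Perm ℕ)) →
      Dynamics.HasMetrizableUniversalMinimalFlow.{0, v} G → Dynamics.GenericPointProperty.{0, v} G)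
    ∧
    -- non-Archimedean Polish groups
    (∀ (H : Type u) [Group H] [TopologicalSpace H] [NonarchimedeanGroup H] [PolishSpace H],
      Dynamics.HasMetrizableUniversalMinimalFlow.{u, v} H → Dynamics.GenericPointProperty.{u, v} H)
    ∧
    -- closed subgroups are the automorphism groups of relational Fraïssé structures on `ℕ`
    (∀ G : Subgroup (Equiv.Perm ℕ), IsClosed (G : Set (Equiv.Perm ℕ)) ↔
      ∃ (L : FirstOrder.Language.{0, 0}) (_ : L.IsRelational) (_ : L.Structure ℕ),
        L.IsUltrahomogeneous ℕ ∧ Dynamics.autGroup L = G)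
    ∧
    -- the generic orbit is the orbit of the limit of an excellent expansion
    (∀ (L : FirstOrder.Language.{a, b}) [L.IsRelational] [L.Structure ℕ],
      L.IsUltrahomogeneous ℕ →
      Dynamics.HasMetrizableUniversalMinimalFlow.{0, v} (Dynamics.autGroup L) →
      ∃ (S : FirstOrder.Language.{0, 0}) (_ : S.IsRelational) (_ : Countable S.Symbols)
        (𝒦s : Set (CategoryTheory.Bundled.{0} (L.sum S).Structure)),
        Dynamics.IsExcellent 𝒦s (L.age ℕ) ∧
        ∃ s : Dynamics.ExpansionSpace 𝒦s, Dynamics.IsLimit s ∧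
          ∀ (M : Type v) [TopologicalSpace M] [MulAction (Dynamics.autGroup L)ᵐᵒᵖ M],
            Dynamics.IsUniversalMinimalFlow (Dynamics.autGroup L) M →
            ∃ φ : Dynamics.ExpansionSpace 𝒦s ≃ₜ M, Dynamics.IsGMap (Dynamics.autGroup L) φ ∧
              ∀ y : M, Dynamics.HasGenericOrbit (Dynamics.autGroup L) y ↔
                y ∈ MulAction.orbit (Dynamics.autGroup L)ᵐᵒᵖ (φ s)) := by
  refine ⟨Dynamics.genericPointProperty_of_isClosed, ?_,
    Dynamics.isClosed_iff_exists_isUltrahomogeneous, ?_⟩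
  · intro H _ _ _ _
    obtain ⟨G, hG, e, he, he'⟩ := Dynamics.exists_mulEquiv_closed_subgroup H
    exact Dynamics.genericPointProperty_of_mulEquiv e he he'
      (Dynamics.genericPointProperty_of_isClosed G hG)
  · intro L _ _
    exact Dynamics.exists_excellent_expansion L
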